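/- **Theorem (performance of MultiBags+).** Consider task-parallel programs whose instructions are unit-cost computation steps, reads and writes of memory locations, ordinary calls, $\mathtt{spawn}$ of a function, $\mathtt{sync}$ (which joins all children spawned so far by the current function instance, and is performed implicitly when a function returns), $\mathtt{create}$ of a future, and $\mathtt{get}$ of a future. Futures are general (unstructured): any function instance may $\mathtt{get}$ any future, any number of times. The program is run sequentially in depth-first eager order, so that the body of a spawned function or of a future runs to completion before the continuation of its creator, and this run reaches its end, i.e. every $\mathtt{get}$ refers to a future that has already completed. For the run let * $T_1$ be the work, i.e. the number of instructions executed; * $m$ be the number of memory accesses; * $n$ be the number of $\mathtt{spawn}$ and $\mathtt{create}$ operations; * $k$ be the number of $\mathtt{create}$ and $\mathtt{get}$ operations; * $\alpha(m,n)=\min\{i\ge 1 : A(i,\lfloor m/n\rfloor)\ge\log_2 n\}$ be the inverse Ackermann function, where $A$ is the Ackermann–Péter function (and $\alpha(m,0)=1$). MultiBags+ is the following on-the-fly race detector. It keeps two disjoint-set structures over the strands (union by rank, path compression) and a reachability matrix $\mathcal R$. A strand is a maximal run of instructions without parallel control; a $\mathtt{sync}$ is treated as a sequence of binary joins, most recent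 child first. * $D_{SP}$. The first strand of every function instance $F$ starts an $S$-bag $S_F$, to which the later strands of $F$ are added. When a spawned function or future $G$ returns, its $S$-bag becomes a $P$-bag $P_G$; when $F$ joins a spawned $G$, $P_G$ is merged into $S_F$; a $\mathtt{get}$ merges nothing. * $D_{NSP}$ and $\mathcal R$. Every set of $D_{NSP}$ is either attached, and then is a node of $\mathcal R$, or unattached, and then has an attached predecessor and possibly an attached successor. To attachify an unattached set is to insert it into $\mathcal R$ with an arc from its attached predecessor. The very first strand is attached. * At a $\mathtt{spawn}$ ending strand $f$, the first strands of the child and of the continuation become unattached sets, whose attached predecessor is the set of $f$ if that is attached and the attached predecessor of this set otherwise. * At a $\mathtt{create}$ ending strand $u$, the set of $u$ is attachified, and the first strands of the future and of the continuation become attached sets with an arc from the set of $u$. * At a $\mathtt{get}$ ending strand $u$, the set of $u$ is attachified, and the next strand becomes an attached set with arcs from the set of $u$ and from the set of the last strand of the future. * At a join strand $j$ that closes the spawn ending strand $f$, let the two branches have first strands $s_1,s_2$ and last strands $t_1,t_2$. If $t_1,t_2$ are both in unattached sets, these sets and $j$ are merged into the set of $f$. If both are in attached sets, the set of $f$ is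 attachified, with arcs to the sets of $s_1$ and $s_2$, and $j$ becomes an attached set with arcs from those of $t_1$ and $t_2$. If only $t_a$ is in an attached set, the set of $f$ is merged into that of $s_a$ if it is unattached, $j$ is merged into the set of $t_a$, and this set becomes the attached successor of the set of the other last strand. * Inserting a node into $\mathcal R$ computes its row and its column of the reachability matrix from those of its given neighbours. * Query whether an earlier strand $u$ precedes the current strand $v$: yes if $u$ is in an $S$-bag. Otherwise let $a$ be the set of $u$ in $D_{NSP}$ if attached, else its attached successor (if there is none, the answer is no), and let $b$ be the set of $v$ if attached, else its attached predecessor; answer whether $a$ reaches $b$ in $\mathcal R$. * Every location stores its last writer and the readers since the last write. A read queries the last writer against the current strand, a write queries the last writer and all these readers and then clears the readers; every negative answer is reported as a race. The running time counts one step for every instruction of the program and for every table entry read or written by the detector. Then there is an absolute constant $C$ such that, for every such program, the execution together with race detection by MultiBags+ takes at most $$C\,\bigl(T_1\,\alpha(m,n)+k^2\bigr)$$ steps in total. Moreover, MultiBags+ creates at most $C(k+1)$ attached sets, and the insertion of each of them into $\mathcal R$ takes at most $C(k+1)$ steps. -/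

import Mathlib

namespace FutureRace

/-! ### Programs with general futures -/

/-- The unfolding of one function instance, as met by the sequential depth-first eager execution:
the instructions that the instance performs, in order, up to its `ret`.  Memory locations are
numbered.  Futures are numbered `0, 1, 2, …` in the order in which the sequential execution creates
them, and `get i` joins future number `i`; a future may be joined any number of times (or never),
by any function instance.  `sync` joins all the children that the instance has spawned so far, and
there is an implicit `sync` at `ret`; futures are joined by `get` only.  `call` is an ordinary
sequential call. -/
inductive Code : Type
  | ret : Code
  | compute (rest : Code) : Code
  | read (l : ℕ) (rest : Code) : Code
  | write (l : ℕ) (rest : Code) : Code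
  | call (body rest : Code) : Code
  | spawn (body rest : Code) : Code
  | create (body rest : Code) : Code
  | get (i : ℕ) (rest : Code) : Code
  | sync (rest : Code) : Code

namespace Code

/-- The work `T₁`: the number of instructions executed. -/
def work : Code → ℕ
  | ret => 1
  | compute r => r.work + 1
  | read _ r => r.work + 1
  | write _ r => r.work + 1
  | call b r => b.work + r.work + 1
  | spawn b r => b.work + r.work + 1
  | create b r => b.work + r.work + 1
  | get _ r => r.work + 1
  | sync r => r.work + 1

/-- The number `m` of memory accesses. -/
def accesses : Code → ℕ
  | ret => 0
  | compute r => r.accesses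
  | read _ r => r.accesses + 1
  | write _ r => r.accesses + 1
  | call b r => b.accesses + r.accesses
  | spawn b r => b.accesses + r.accesses
  | create b r => b.accesses + r.accesses
  | get _ r => r.accesses
  | sync r => r.accesses

/-- The number `n` of places at which parallelism is created: `spawn` and `create` operations. -/
def forks : Code → ℕ
  | ret => 0
  | compute r => r.forks
  | read _ r => r.forks
  | write _ r => r.forks
  | call b r => b.forks + r.forks
  | spawn b r => b.forks + r.forks + 1
  | create b r => b.forks + r.forks + 1
  | get _ r => r.forks
  | sync r => r.forks

/-- The number `k` of future operations: `create` and `get`. -/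
def futureOps : Code → ℕ
  | ret => 0
  | compute r => r.futureOps
  | read _ r => r.futureOps
  | write _ r => r.futureOps
  | call b r => b.futureOps + r.futureOps
  | spawn b r => b.futureOps + r.futureOps
  | create b r => b.futureOps + r.futureOps + 1
  | get _ r => r.futureOps + 1
  | sync r => r.futureOps

/-- Depth-first eager execution as far as futures are concerned: the state is the number of futures
created so far and the set of those that have completed.  A spawned or created body runs to
completion before its continuation.  A `get` of a future that has not completed blocks (`none`). -/
def eager : Code → ℕ × Finset ℕ → Option (ℕ × Finset ℕ)
  | ret, s => some s
  | compute r, s => r.eager s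
  | read _ r, s => r.eager s
  | write _ r, s => r.eager s
  | call b r, s => (b.eager s).bind r.eager
  | spawn b r, s => (b.eager s).bind r.eager
  | create b r, s => (b.eager (s.1 + 1, s.2)).bind fun s' => r.eager (s'.1, insert s.1 s'.2)
  | get i r, s => if i ∈ s.2 then r.eager s else none
  | sync r, s => r.eager s

/-- The depth-first eager execution of the program runs to its end: every `get` refers to a future
that has completed by then. -/
def Runs (p : Code) : Prop := (p.eager (0, ∅)).isSome

end Code

/-! ### The inverse Ackermann function -/

/-- `α(m, n) = min {i ≥ 1 : A(i, ⌊m / n⌋) ≥ log₂ n}`, with the Ackermann–Péter function `A`.  As `A`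
takes integer values, `log₂ n` may be rounded up. -/
noncomputable def invAck (m n : ℕ) : ℕ :=
  sInf {i : ℕ | 1 ≤ i ∧ Nat.clog 2 n ≤ ack i (m / n)}

/-! ### Disjoint sets: union by rank and path compression, with step counts -/

/-- A disjoint-set forest on the elements `0, …, size - 1`. -/
structure Forest where
  size : ℕ
  parent : ℕ → ℕ
  rank : ℕ → ℕ

namespace Forest

def empty : Forest := ⟨0, id, fun _ => 0⟩

/-- Make-Set: the new element is `d.size`. -/
def makeSet (d : Forest) : Forest :=
  ⟨d.size + 1, Function.update d.parent d.size d.size, Function.update d.rank d.size 0⟩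

/-- Find with path compression along at most `fuel` parent links: the representative, the
compressed forest, and the number of steps (one for each parent entry read or written). -/
def findAux (d : Forest) : ℕ → ℕ → ℕ × Forest × ℕ
  | 0, x => (x, d, 1)
  | fuel + 1, x =>
    if d.parent x = x then (x, d, 1)
    else
      let res := findAux d fuel (d.parent x)
      (res.1, { res.2.1 with parent := Function.update res.2.1.parent x res.1 }, res.2.2 + 2)

/-- Find.  A path to a root has fewer than `d.size` links, so that the fuel never runs out. -/
def find (d : Forest) (x : ℕ) : ℕ × Forest × ℕ := d.findAux d.size x

/-- Union: the new representative, the new forest, and the number of steps. -/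
def union (d : Forest) (x y : ℕ) : ℕ × Forest × ℕ :=
  let fx := d.find x
  let fy := fx.2.1.find y
  let e := fy.2.1
  let a := fx.1
  let b := fy.1
  let c := fx.2.2 + fy.2.2 + 4
  if a = b then (a, e, c)
  else if e.rank a < e.rank b then
    (b, { e with parent := Function.update e.parent a b }, c)
  else if e.rank b < e.rank a then
    (a, { e with parent := Function.update e.parent b a }, c)
  else
    (a, { e with
      parent := Function.update e.parent b a
      rank := Function.update e.rank a (e.rank a + 1) }, c)

end Forest

/-! ### The detector

Strands (maximal runs of instructions without parallel control) are numbered in the order in which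
they are allocated; they are the elements of both disjoint-set structures.  Tables are functions on
`ℕ`.  Every operation charges one step for each table entry that it reads or writes and for each
instruction of the program. -/

structure Detector where
  /-- `D_SP`, whose sets are the `S`- and `P`-bags of function instances -/
  sp : Forest
  /-- for a representative of `D_SP`: is the set an `S`-bag (otherwise a `P`-bag)? -/
  isS : ℕ → Bool
  /-- `D_NSP`, whose sets are the attached and unattached sets -/
  nsp : Forest
  /-- for a representative of `D_NSP`: the node of `R` if the set is attached, `none` otherwise -/
  att : ℕ → Option ℕ
  /-- for a representative of an unattached set: its attached predecessor (a node of `R`) -/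
  attPred : ℕ → ℕ
  /-- for a representative of an unattached set: its attached successor, if there is one -/
  attSucc : ℕ → Option ℕ
  /-- number of nodes of `R` -/
  rSize : ℕ
  /-- the strict reachability matrix of `R`, which is kept transitively closed -/
  reach : ℕ → ℕ → Bool
  /-- number of futures created so far -/
  futCount : ℕ
  /-- the last strand of a completed future -/
  futLast : ℕ → ℕ
  /-- access history: the strand that last wrote a location -/
  lastWriter : ℕ → Option ℕ
  /-- access history: the strands that have read a location since it was last written -/
  readers : ℕ → List ℕ
  /-- races reported: location, earlier strand, later strand -/
  races : List (ℕ × ℕ × ℕ)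
  /-- total number of steps so far -/
  steps : ℕ
  /-- for every insertion of a node into `R` so far (every attached set created), its number of
  steps; a record for the analysis only -/
  insertLog : List ℕ

def Detector.init : Detector where
  sp := Forest.empty
  isS := fun _ => false
  nsp := Forest.empty
  att := fun _ => none
  attPred := fun _ => 0
  attSucc := fun _ => none
  rSize := 0
  reach := fun _ _ => false
  futCount := 0
  futLast := fun _ => 0
  lastWriter := fun _ => none
  readers := fun _ => []
  races := []
  steps := 0
  insertLog := []

abbrev DetM (β : Type) : Type := StateM Detector β

def tick (c : ℕ) : DetM Unit := modify fun s => { s with steps := s.steps + c }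

/-! #### Disjoint-set operations -/

def findSP (x : ℕ) : DetM ℕ := do
  let s ← get
  let f := s.sp.find x
  set { s with sp := f.2.1, steps := s.steps + f.2.2 }
  return f.1

def findNSP (x : ℕ) : DetM ℕ := do
  let s ← get
  let f := s.nsp.find x
  set { s with nsp := f.2.1, steps := s.steps + f.2.2 }
  return f.1

/-- Allocate a strand: a singleton `S`-bag in `D_SP` and a singleton unattached set in `D_NSP`. -/
def newStrand : DetM ℕ := do
  tick 10
  let s ← get
  let x := s.nsp.size
  set { s with
    sp := s.sp.makeSet
    nsp := s.nsp.makeSet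
    isS := Function.update s.isS x true
    att := Function.update s.att x none
    attPred := Function.update s.attPred x 0
    attSucc := Function.update s.attSucc x none }
  return x

/-- Union in `D_SP`; the result is an `S`-bag. -/
def unionSP (x y : ℕ) : DetM Unit := do
  tick 1
  let s ← get
  let u := s.sp.union x y
  set { s with sp := u.2.1, isS := Function.update s.isS u.1 true, steps := s.steps + u.2.2 }

/-- The bag that contains strand `x` becomes a `P`-bag. -/
def toP (x : ℕ) : DetM Unit := do
  tick 1
  let r ← findSP x
  modify fun s => { s with isS := Function.update s.isS r false }

/-- Union in `D_NSP`: the set of `y` is merged into the set of `x`, whose status (attached or not,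
attached predecessor and successor) is kept. -/
def unionNSP (x y : ℕ) : DetM Unit := do
  tick 6
  let a ← findNSP x
  let s ← get
  let u := s.nsp.union x y
  set { s with
    nsp := u.2.1
    att := Function.update s.att u.1 (s.att a)
    attPred := Function.update s.attPred u.1 (s.attPred a)
    attSucc := Function.update s.attSucc u.1 (s.attSucc a)
    steps := s.steps + u.2.2 }

/-- The node of `R` of the set of `x` if this set is attached, `none` otherwise. -/
def attachedSet (x : ℕ) : DetM (Option ℕ) := do
  tick 1
  let r ← findNSP x
  return (← get).att r

/-- The set of `x` itself if it is attached, otherwise its attached predecessor. -/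
def predProxy (x : ℕ) : DetM ℕ := do
  tick 2
  let r ← findNSP x
  let s ← get
  return (s.att r).getD (s.attPred r)

/-- The set of `x` itself if it is attached, otherwise its attached successor, if it has one. -/
def succProxy (x : ℕ) : DetM (Option ℕ) := do
  tick 2
  let r ← findNSP x
  let s ← get
  return (s.att r).or (s.attSucc r)

def setAttPred (x a : ℕ) : DetM Unit := do
  tick 1
  let r ← findNSP x
  modify fun s => { s with attPred := Function.update s.attPred r a }

def setAttSucc (x a : ℕ) : DetM Unit := do
  tick 1
  let r ← findNSP x
  modify fun s => { s with attSucc := Function.update s.attSucc r (some a) }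

def setAttached (x a : ℕ) : DetM Unit := do
  tick 1
  let r ← findNSP x
  modify fun s => { s with att := Function.update s.att r (some a) }

/-! #### The reachability structure `R` -/

def readR (a b : ℕ) : DetM Bool := do
  tick 1
  return (← get).reach a b

def writeR (a b : ℕ) (v : Bool) : DetM Unit := do
  tick 1
  modify fun s => { s with reach := Function.update s.reach a (Function.update (s.reach a) b v) }

/-- Does node `y` equal or reach one of the given nodes? -/
def reachesAny (y : ℕ) : List ℕ → DetM Bool
  | [] => pure false
  | p :: ps => do
    let b ← readR y p
    let c ← reachesAny y ps
    return (y == p || b || c)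

/-- Is node `y` equal to or reached from one of the given nodes? -/
def reachedFromAny (y : ℕ) : List ℕ → DetM Bool
  | [] => pure false
  | q :: qs => do
    let b ← readR q y
    let c ← reachedFromAny y qs
    return (y == q || b || c)

/-- Fill in the column and the row of node `x` of the reachability matrix at the nodes below the
given bound. -/
def fillR (x : ℕ) (preds succs : List ℕ) : ℕ → DetM Unit
  | 0 => pure ()
  | y + 1 => do
    let b ← reachesAny y preds
    writeR y x b
    let c ← reachedFromAny y succs
    writeR x y c
    fillR x preds succs y

/-- Insert a new node into `R`, with an arc from every node of `preds` and an arc to every node of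
`succs`. -/
def insertR (preds succs : List ℕ) : DetM ℕ := do
  let s₀ ← get
  let x := s₀.rSize
  tick 2
  fillR x preds succs x
  writeR x x false
  modify fun s => { s with
    rSize := x + 1
    insertLog := (s.steps - s₀.steps) :: s.insertLog }
  return x

/-- Attachify: unless it is attached already, the set of `x` becomes an attached set, with an arc
from its attached predecessor and arcs to `succs`.  The result is its node of `R`. -/
def attachify (x : ℕ) (succs : List ℕ) : DetM ℕ := do
  match ← attachedSet x with
  | some a => return a
  | none =>
    let p ← predProxy x
    let a ← insertR [p] succs
    setAttached x a
    return a

/-- The new strand `x` becomes an attached set of its own, with arcs from `preds`. -/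
def attachNew (x : ℕ) (preds : List ℕ) : DetM Unit := do
  let a ← insertR preds []
  setAttached x a

/-! #### Parallel control -/

/-- A spawn that has not been joined yet: the strand that ends with it, the first strand of the
child, the first strand of the continuation, and the last strand of the child. -/
structure Pending where
  fork : ℕ
  child : ℕ
  cont : ℕ
  childEnd : ℕ

/-- Strand `f`, of the function instance whose first strand is `first`, ends with a `spawn`.
Returns the first strands of the child and of the continuation. -/
def onSpawn (first f : ℕ) : DetM (ℕ × ℕ) := do
  let v ← newStrand
  let w ← newStrand
  unionSP first w
  let a ← predProxy f
  setAttPred v a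
  setAttPred w a
  return (v, w)

/-- Strand `u` ends with a `create`.  Returns the first strands of the future and of the
continuation. -/
def onCreate (first u : ℕ) : DetM (ℕ × ℕ) := do
  let v ← newStrand
  let w ← newStrand
  unionSP first w
  let a ← attachify u []
  attachNew v [a]
  attachNew w [a]
  return (v, w)

/-- Strand `u` ends with a `get` of future `i`.  Returns the strand that follows. -/
def onGet (first u i : ℕ) : DetM ℕ := do
  let w ← newStrand
  unionSP first w
  let a ← attachify u []
  tick 1
  let t := (← get).futLast i
  let b ← attachedSet t
  attachNew w (a :: b.toList)
  return w

/-- Join one spawned child with strand `t` of its parent.  Returns the join strand. -/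
def joinOne (first t : ℕ) (J : Pending) : DetM ℕ := do
  tick 1
  let j ← newStrand
  unionSP first J.child
  unionSP first j
  let a₁ ← attachedSet J.childEnd
  let a₂ ← attachedSet t
  match a₁, a₂ with
  | none, none =>
    unionNSP J.fork J.childEnd
    unionNSP J.fork t
    unionNSP J.fork j
  | some a₁, some a₂ =>
    let c₁ ← attachedSet J.child
    let c₂ ← attachedSet J.cont
    let _ ← attachify J.fork (c₁.toList ++ c₂.toList)
    attachNew j [a₁, a₂]
  | some a₁, none =>
    if (← attachedSet J.fork).isNone then unionNSP J.child J.fork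
    unionNSP J.childEnd j
    setAttSucc t a₁
  | none, some a₂ =>
    if (← attachedSet J.fork).isNone then unionNSP J.cont J.fork
    unionNSP t j
    setAttSucc J.childEnd a₂
  return j

/-- `sync`: join all outstanding children, the most recent one first.  Returns the strand that
follows. -/
def onSync (first t : ℕ) : List Pending → DetM ℕ
  | [] => pure t
  | J :: js => do
    let j ← joinOne first t J
    onSync first j js

def newFuture : DetM ℕ := do
  tick 1
  let s ← get
  set { s with futCount := s.futCount + 1 }
  return s.futCount

def finishFuture (i t : ℕ) : DetM Unit := do
  tick 1
  modify fun s => { s with futLast := Function.update s.futLast i t }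

/-! #### Memory accesses -/

/-- Does the earlier strand `u` precede the currently executing strand `v`? -/
def query (u v : ℕ) : DetM Bool := do
  tick 1
  let r ← findSP u
  if (← get).isS r then return true
  match ← succProxy u with
  | none => return false
  | some a =>
    let b ← predProxy v
    readR a b

/-- Query strand `u` against the current strand `v`, and report a race on `l` if they are
parallel. -/
def checkRace (l u v : ℕ) : DetM Unit := do
  if !(← query u v) then
    tick 1
    modify fun s => { s with races := (l, u, v) :: s.races }

def checkAll (l v : ℕ) : List ℕ → DetM Unit
  | [] => pure ()
  | u :: us => do
    tick 1
    checkRace l u v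
    checkAll l v us

def onRead (l v : ℕ) : DetM Unit := do
  tick 2
  checkAll l v ((← get).lastWriter l).toList
  modify fun s => { s with readers := Function.update s.readers l (v :: s.readers l) }

def onWrite (l v : ℕ) : DetM Unit := do
  tick 4
  checkAll l v ((← get).lastWriter l).toList
  checkAll l v ((← get).readers l)
  modify fun s => { s with
    lastWriter := Function.update s.lastWriter l (some v)
    readers := Function.update s.readers l [] }

/-! #### The run -/

/-- Depth-first eager execution under the detector.  `first` is the first strand of the current
function instance, `cur` the currently executing strand, and `pend` holds the outstanding children,
the most recent one first.  Returns the last strand. -/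
def exec : Code → (first cur : ℕ) → List Pending → DetM ℕ
  | .ret, first, cur, pend => do
    tick 1
    onSync first cur pend
  | .compute rest, first, cur, pend => do
    tick 1
    exec rest first cur pend
  | .read l rest, first, cur, pend => do
    tick 1
    onRead l cur
    exec rest first cur pend
  | .write l rest, first, cur, pend => do
    tick 1
    onWrite l cur
    exec rest first cur pend
  | .call body rest, first, cur, pend => do
    tick 1
    let t ← exec body first cur []
    exec rest first t pend
  | .spawn body rest, first, cur, pend => do
    tick 1
    let (v, w) ← onSpawn first cur
    let t ← exec body v v []
    toP v
    exec rest first w (⟨cur, v, w, t⟩ :: pend)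
  | .create body rest, first, cur, pend => do
    tick 1
    let (v, w) ← onCreate first cur
    let i ← newFuture
    let t ← exec body v v []
    toP v
    finishFuture i t
    exec rest first w pend
  | .get i rest, first, cur, pend => do
    tick 1
    let w ← onGet first cur i
    exec rest first w pend
  | .sync rest, first, cur, pend => do
    tick 1
    let j ← onSync first cur pend
    exec rest first j []

/-- The final state of MultiBags+ on a program.  The first strand forms an attached set. -/
def multiBagsPlus (p : Code) : Detector :=
  let run : DetM Unit := do
    let x ← newStrand
    attachNew x []
    let _ ← exec p x x []
    toP x
  (run.run Detector.init).2

end FutureRace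

namespace FutureRace

/-! Three accountings are combined: one for the disjoint-set forests, one for the memory accesses,
one for the attached sets.

Disjoint sets. An element of rank `r` whose parent has rank `q` carries the potential `slack`: for
functions `f_0, …, f_i` of a fast-growing hierarchy it counts the iterates of `f_k` at `r` that `q`
has not reached, with only `b + 2` iterates counted on the top level. A find is paid for by the drop
of potential except at one element per level: if a higher element of the path already represents
level `k`, compression carries the parent's rank past one more iterate of `f_k` (`slack_lt`,
`Forest.findAux_spec`). So find and union cost `O(i + 1)` and a new element costs `i + b + 2`, as
long as all ranks are at most `f_i (b + 1)`; ranks are at most the binary logarithm of the number of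
strands.

Memory accesses. A read prepays the query that the next write to its location makes against it, so
every access has amortised cost `O(i + 1)`.

Attached sets. Call a strand live if it is current, or is the fork or the last strand of an
outstanding child, in any active function instance. Live strands in unattached sets lie in different
sets, so merging or attaching such a set changes the status of no other live strand. The quantity
"insertions plus twice the number of attached live strands" does not grow at a join
(`joinOne_spec`): only a join of two attached ends inserts, at most two nodes, and it replaces two
attached live strands by one. Only `create` and `get` raise the quantity, by at most 7 each, so
there are `O(k + 1)` insertions, each filling one row and one column of length `O(k + 1)`.

Conclusion. There are at most `3n + k + 1` strands. For `k ≤ n` take `i = α(m, n)` and `b = ⌊m/n⌋ +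
3`: the new elements contribute a term `O(b (n + 1)) = O(m + n + 1)` beyond `O(T₁ α)`. For `k > n`
take `i = 1` and `b = 4k`: this term is `O(k²)`. -/

/-! ### A fast-growing hierarchy -/

/-- A hierarchy of the growth of the Ackermann function: each function iterates the one before it
`r + 1` times, starting at `r`. -/
def fastGrow : ℕ → ℕ → ℕ
  | 0, r => r + 1
  | k + 1, r => (fastGrow k)^[r + 1] r

theorem add_le_iterate {f : ℕ → ℕ} (hf : ∀ r, r < f r) (j r : ℕ) : r + j ≤ f^[j] r := by
  induction j with
  | zero => simp
  | succ j ih =>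
    rw [Function.iterate_succ_apply']
    have := hf (f^[j] r)
    omega

theorem lt_fastGrow (k r : ℕ) : r < fastGrow k r := by
  induction k generalizing r with
  | zero => simp [fastGrow]
  | succ k ih =>
    have := add_le_iterate ih (r + 1) r
    simp only [fastGrow]
    omega

theorem fastGrow_mono (k : ℕ) : Monotone (fastGrow k) := by
  induction k with
  | zero => intro a b h; simpa [fastGrow] using h
  | succ k ih =>
    intro a b h
    obtain ⟨c, rfl⟩ := Nat.exists_eq_add_of_le h
    simp only [fastGrow]
    calc (fastGrow k)^[a + 1] a ≤ (fastGrow k)^[a + 1] (a + c) := ih.iterate _ (by omega)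
      _ ≤ (fastGrow k)^[c] ((fastGrow k)^[a + 1] (a + c)) := by
          have := add_le_iterate (lt_fastGrow k) c ((fastGrow k)^[a + 1] (a + c))
          omega
      _ = (fastGrow k)^[a + c + 1] (a + c) := by
          rw [show a + c + 1 = c + (a + 1) by omega, Function.iterate_add_apply _ c]

theorem ack_succ_eq_iterate (k r : ℕ) : ack (k + 1) r = (ack k)^[r + 1] 1 := by
  induction r with
  | zero => simp
  | succ r ih => rw [ack_succ_succ, ih, Function.iterate_succ_apply' _ (r + 1)]

/-- Both sides at level `k + 1` iterate level `k` exactly `r + 1` times, from `1` and from `r`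
respectively. At `r = 0` it fails: `ack 1 0 = 2` but `fastGrow 1 0 = 1`. -/
theorem ack_le_fastGrow (k : ℕ) {r : ℕ} (hr : 1 ≤ r) : ack k r ≤ fastGrow k r := by
  induction k generalizing r with
  | zero => simp [fastGrow]
  | succ k ih =>
    rw [ack_succ_eq_iterate, fastGrow]
    have key : ∀ j, (ack k)^[j] 1 ≤ (fastGrow k)^[j] r := by
      intro j
      induction j with
      | zero => simpa using hr
      | succ j ihj =>
        rw [Function.iterate_succ_apply', Function.iterate_succ_apply']
        have h1 := add_le_iterate (lt_fastGrow k) j r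
        exact (ack_mono_right k ihj).trans (ih (by omega))
    exact key _

/-- By strict monotonicity, shifting the argument by `c` gains at least `c`. This absorbs the
additive constant by which the logarithm of the number of strands exceeds that of `n`. -/
theorem ack_add_le_fastGrow (k x c : ℕ) (hc : 1 ≤ c) : ack k x + c ≤ fastGrow k (x + c) := by
  refine le_trans ?_ (ack_le_fastGrow k (by omega))
  clear hc
  induction c with
  | zero => simp
  | succ c ih =>
    have := ack_strictMono_right k (show x + c < x + (c + 1) by omega)
    omega

/-! ### Amortised analysis of disjoint-set forests -/

/-- The potential of an element of rank `r` whose parent has rank `q`: the number of iterates of the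
hierarchy, started at `r`, that `q` has not reached yet. -/
def slack (i d r q : ℕ) : ℕ :=
  ∑ k ∈ Finset.range i, {j ∈ Finset.range (r + 1) | q < (fastGrow k)^[j + 1] r}.card +
    {j ∈ Finset.range (d + 2) | q < (fastGrow i)^[j + 1] r}.card

theorem slack_anti (i d r : ℕ) {q q' : ℕ} (h : q ≤ q') : slack i d r q' ≤ slack i d r q := by
  unfold slack
  gcongr

theorem slack_zero (i d r : ℕ) : slack i d r 0 = i * (r + 1) + (d + 2) := by
  have key : ∀ k c, {j ∈ Finset.range c | 0 < (fastGrow k)^[j + 1] r} = Finset.range c := by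
    intro k c
    refine Finset.filter_true_of_mem fun j _ => ?_
    have := add_le_iterate (lt_fastGrow k) (j + 1) r
    omega
  simp only [slack, key, Finset.card_range, Finset.sum_const, smul_eq_mul]

/-- The index that leaves the set is the least `j` with `q < f^[j + 1] r`. It is positive by `h0`,
so `f^[j] r ≤ q`, and applying `f` once more gives `f^[j + 1] r ≤ f q ≤ q'`. -/
theorem filter_card_lt {f : ℕ → ℕ} (hf : Monotone f) {c r q q' : ℕ} (h0 : f r ≤ q)
    (hc : ∃ j < c, q < f^[j + 1] r) (hq : q ≤ q') (hq' : f q ≤ q') :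
    {j ∈ Finset.range c | q' < f^[j + 1] r}.card < {j ∈ Finset.range c | q < f^[j + 1] r}.card := by
  classical
  have hex : ∃ j, q < f^[j + 1] r := hc.imp fun _ h => h.2
  obtain ⟨j₀, hj₀, hj₀'⟩ := hc
  have hle : Nat.find hex ≤ j₀ := Nat.find_min' hex hj₀'
  have hspec := Nat.find_spec hex
  have hpos : Nat.find hex ≠ 0 := by
    intro h
    rw [h] at hspec
    simp at hspec
    omega
  have hmin := Nat.find_min hex (m := Nat.find hex - 1) (by omega)
  rw [Nat.sub_add_cancel (by omega)] at hmin
  apply Finset.card_lt_card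
  rw [Finset.ssubset_iff_of_subset (Finset.monotone_filter_right _ fun a _ ha => hq.trans_lt ha)]
  refine ⟨Nat.find hex, Finset.mem_filter.2 ⟨Finset.mem_range.2 (by omega), hspec⟩, ?_⟩
  simp only [Finset.mem_filter, not_and, not_lt]
  intro _
  rw [Function.iterate_succ_apply']
  exact (hf (not_lt.mp hmin)).trans hq'

/-- The gain from path compression at an element of level `k`: its new parent rank `q'` is at least
one application of `fastGrow k` above the old one. -/
theorem slack_lt {i d r q q' k : ℕ} (hk : k ≤ i) (hrq : fastGrow k r ≤ q)
    (hmax : k < i → q < fastGrow (k + 1) r) (hq : fastGrow k q ≤ q')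
    (hR : q' ≤ fastGrow i (d + 1)) : slack i d r q' < slack i d r q := by
  have hqq : q ≤ q' := (lt_fastGrow k q).le.trans hq
  unfold slack
  rcases hk.lt_or_eq with hk | rfl
  · apply add_lt_add_of_lt_of_le
    · apply Finset.sum_lt_sum
      · intro k' _
        gcongr
      -- Below the top level the iterate with `j = r` is unreached, since it equals `fastGrow (k +
      -- 1) r`.
      · exact ⟨k, by simpa using hk, filter_card_lt (fastGrow_mono k) hrq
          ⟨r, by omega, hmax hk⟩ hqq hq⟩
    · gcongr
  · apply add_lt_add_of_le_of_lt
    · gcongr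
    -- On the top level `d + 1` iterates already exceed `d`, so one more is at least `fastGrow k (d
    -- + 1)`, the bound on all ranks. This is why `slack` counts `d + 2` iterates there.
    · refine filter_card_lt (fastGrow_mono k) hrq ⟨d + 1, by omega, ?_⟩ hqq hq
      rw [Function.iterate_succ_apply']
      have h1 := add_le_iterate (lt_fastGrow k) (d + 1) r
      have h2 := fastGrow_mono k (show d + 1 ≤ (fastGrow k)^[d + 1] r by omega)
      have h3 := lt_fastGrow k q
      omega

/-! ### Well-formed forests and representatives. -/

namespace Forest

/-- The invariants of union by rank. -/
structure Wf (d : Forest) : Prop where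
  lt_size : ∀ x, d.parent x ≠ x → x < d.size ∧ d.parent x < d.size
  rank_lt : ∀ x, d.parent x ≠ x → d.rank x < d.rank (d.parent x)
  pow_rank_le : ∀ x < d.size, 2 ^ d.rank x ≤ d.size
  sum_roots_le : ∑ x ∈ Finset.range d.size with d.parent x = x, 2 ^ d.rank x ≤ d.size

theorem Wf.rank_lt_size {d : Forest} (h : d.Wf) {x : ℕ} (hx : x < d.size) : d.rank x < d.size :=
  (Nat.lt_two_pow_self).trans_le (h.pow_rank_le x hx)

theorem Wf.parent_lt {d : Forest} (h : d.Wf) {x : ℕ} (hx : x < d.size) : d.parent x < d.size := by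
  by_cases hp : d.parent x = x
  · rwa [hp]
  · exact (h.lt_size x hp).2

/-- Induction along parent links. -/
theorem Wf.induction {d : Forest} (h : d.Wf) {motive : ℕ → Prop}
    (root : ∀ x, d.parent x = x → motive x)
    (step : ∀ x, d.parent x ≠ x → motive (d.parent x) → motive x) (x : ℕ) : motive x := by
  have key : ∀ n x, d.size - d.rank x = n → motive x := by
    intro n
    induction n using Nat.strong_induction_on with
    | _ n ih =>
      intro x hx
      by_cases hp : d.parent x = x
      · exact root x hp
      · have h1 := h.rank_lt x hp
        have h2 := h.rank_lt_size (h.lt_size x hp).1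
        exact step x hp (ih _ (by omega) _ rfl)
  exact key _ x rfl

/-- The representative of the set of `x`. -/
def root (d : Forest) (x : ℕ) : ℕ := (d.find x).1

/-- Each link raises the rank, and ranks of non-roots are below `d.size`, so the fuel suffices. To
compute the roots of a modified forest it is then enough to guess an `f` that is constant along
links and fixes roots. -/
theorem findAux_fst_eq {d : Forest} (h : d.Wf) {f : ℕ → ℕ} (hf : ∀ x, f (d.parent x) = f x)
    (hr : ∀ x, d.parent x = x → f x = x) (fuel x : ℕ) (hfuel : d.size ≤ fuel + d.rank x) :
    (d.findAux fuel x).1 = f x := by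
  induction fuel generalizing x with
  | zero =>
    simp only [findAux]
    by_contra hne
    have hp : d.parent x ≠ x := fun hp => hne (hr x hp).symm
    have := h.rank_lt_size (h.lt_size x hp).1
    omega
  | succ fuel ih =>
    simp only [findAux]
    split_ifs with hp
    · exact (hr x hp).symm
    · have := h.rank_lt x hp
      rw [ih _ (by omega), hf]

theorem root_unique {d : Forest} (h : d.Wf) {f : ℕ → ℕ} (hf : ∀ x, f (d.parent x) = f x)
    (hr : ∀ x, d.parent x = x → f x = x) (x : ℕ) : d.root x = f x :=
  findAux_fst_eq h hf hr _ _ (by omega)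

/-- The witness follows `d.size` links; were the result not a root, every link would have raised the
rank, which would then be at least `d.size`. -/
theorem exists_root {d : Forest} (h : d.Wf) :
    ∃ f : ℕ → ℕ, (∀ x, f (d.parent x) = f x) ∧ (∀ x, d.parent x = x → f x = x) ∧
      ∀ x, d.parent (f x) = f x := by
  have hfix : ∀ x, d.parent (d.parent^[d.size] x) = d.parent^[d.size] x := by
    intro x
    by_contra hne
    have key : ∀ j, j ≤ d.size → j ≤ d.rank (d.parent^[j] x) := by
      intro j
      induction j with
      | zero => simp
      | succ j ih =>
        intro hj
        rw [Function.iterate_succ_apply']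
        have h1 : d.parent (d.parent^[j] x) ≠ d.parent^[j] x := by
          intro he
          apply hne
          have : d.parent^[d.size] x = d.parent^[j] x := by
            obtain ⟨c, hc⟩ := Nat.exists_eq_add_of_le (show j ≤ d.size by omega)
            rw [hc, add_comm, Function.iterate_add_apply, Function.iterate_fixed he]
          rw [this, he]
        have := h.rank_lt _ h1
        have := ih (by omega)
        omega
    have h1 := key _ le_rfl
    have h2 := h.rank_lt_size (h.lt_size _ hne).1
    omega
  refine ⟨fun x => d.parent^[d.size] x, fun x => ?_, fun x hx => Function.iterate_fixed hx _, hfix⟩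
  simp only
  rw [← Function.iterate_succ_apply, Function.iterate_succ_apply', hfix]

theorem root_parent {d : Forest} (h : d.Wf) (x : ℕ) : d.root (d.parent x) = d.root x := by
  obtain ⟨f, h1, h2, -⟩ := exists_root h
  rw [root_unique h h1 h2, root_unique h h1 h2, h1]

theorem root_eq_self {d : Forest} (h : d.Wf) {x : ℕ} (hx : d.parent x = x) : d.root x = x := by
  obtain ⟨f, h1, h2, -⟩ := exists_root h
  rw [root_unique h h1 h2, h2 x hx]

theorem parent_root {d : Forest} (h : d.Wf) (x : ℕ) : d.parent (d.root x) = d.root x := by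
  obtain ⟨f, h1, h2, h3⟩ := exists_root h
  rw [root_unique h h1 h2, h3]

theorem root_root {d : Forest} (h : d.Wf) (x : ℕ) : d.root (d.root x) = d.root x :=
  root_eq_self h (parent_root h x)

theorem root_lt {d : Forest} (h : d.Wf) {x : ℕ} (hx : x < d.size) : d.root x < d.size := by
  revert hx
  refine h.induction (motive := fun x => x < d.size → d.root x < d.size) (fun x hp hx => ?_)
    (fun x hp ih hx => ?_) x
  · rwa [root_eq_self h hp]
  · rw [← root_parent h]
    exact ih (h.lt_size x hp).2

theorem rank_le_rank_root {d : Forest} (h : d.Wf) (x : ℕ) : d.rank x ≤ d.rank (d.root x) := by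
  refine h.induction (motive := fun x => d.rank x ≤ d.rank (d.root x)) (fun x hp => ?_)
    (fun x hp ih => ?_) x
  · rw [root_eq_self h hp]
  · rw [root_parent h] at ih
    exact (h.rank_lt x hp).le.trans ih

/-! ### The potential and path compression. -/

/-- The rank of the parent of a non-root, and `0` for a root. -/
def upRank (d : Forest) (x : ℕ) : ℕ := if d.parent x = x then 0 else d.rank (d.parent x)

/-- The potential of a forest. -/
def pot (i b : ℕ) (d : Forest) : ℕ :=
  ∑ x ∈ Finset.range d.size, slack i b (d.rank x) (d.upRank x)

/-- `e` arises from `d` by linking some elements directly to their representatives. -/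
structure Compressed (d e : Forest) : Prop where
  size_eq : e.size = d.size
  rank_eq : e.rank = d.rank
  parent_eq : ∀ x, e.parent x = d.parent x ∨ e.parent x = d.root x

theorem Compressed.parent_eq_self {d e : Forest} (hd : d.Wf) (h : Compressed d e) (x : ℕ) :
    e.parent x = x ↔ d.parent x = x := by
  rcases h.parent_eq x with hx | hx
  · rw [hx]
  · rw [hx]
    constructor
    · intro h; rw [← h, parent_root hd]
    · exact root_eq_self hd

theorem Compressed.wf {d e : Forest} (hd : d.Wf) (h : Compressed d e) : e.Wf where
  lt_size x hx := by
    have hx' := mt (h.parent_eq_self hd x).2 hx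
    have h1 := (hd.lt_size x hx').1
    rw [h.size_eq]
    refine ⟨h1, ?_⟩
    rcases h.parent_eq x with hp | hp <;> rw [hp]
    · exact hd.parent_lt h1
    · exact root_lt hd h1
  rank_lt x hx := by
    have hx' := mt (h.parent_eq_self hd x).2 hx
    have h1 := hd.rank_lt x hx'
    rw [h.rank_eq]
    rcases h.parent_eq x with hp | hp <;> rw [hp]
    · exact h1
    · rw [← root_parent hd]
      exact h1.trans_le (rank_le_rank_root hd _)
  pow_rank_le x hx := by
    rw [h.size_eq] at hx ⊢
    rw [h.rank_eq]
    exact hd.pow_rank_le x hx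
  sum_roots_le := by
    simp only [h.size_eq, h.rank_eq, h.parent_eq_self hd]
    exact hd.sum_roots_le

theorem Compressed.root_eq {d e : Forest} (hd : d.Wf) (h : Compressed d e) (x : ℕ) :
    e.root x = d.root x := by
  refine root_unique (h.wf hd) (fun x => ?_) (fun x hx => ?_) x
  · rcases h.parent_eq x with hp | hp <;> rw [hp]
    · exact root_parent hd x
    · exact root_root hd x
  · exact root_eq_self hd ((h.parent_eq_self hd x).1 hx)

/-- The level of an element of rank `r` under a parent of rank `q`: the last of the functions up to
`i` that does not take `r` beyond `q`. At the cap `k = i` no upper bound is available. -/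
theorem exists_level (i r q : ℕ) (h : r < q) :
    ∃ k ≤ i, fastGrow k r ≤ q ∧ (k < i → q < fastGrow (k + 1) r) := by
  induction i with
  | zero => exact ⟨0, le_rfl, h, fun h => absurd h (lt_irrefl _)⟩
  | succ i ih =>
    obtain ⟨k, hk, h1, h2⟩ := ih
    rcases hk.lt_or_eq with hk | rfl
    · exact ⟨k, by omega, h1, fun _ => h2 hk⟩
    · by_cases h3 : fastGrow (k + 1) r ≤ q
      · exact ⟨k + 1, le_rfl, h3, fun h => absurd h (lt_irrefl _)⟩
      · exact ⟨k, by omega, h1, fun _ => not_le.mp h3⟩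

/-- `S` collects the levels already met higher on the path. Only the first element met of each
level, counted from the root downwards, is unpaid; every other one loses potential, and the factor 2
matches the two steps per link. The second clause ensures that the recursive call has not moved the
parent of the element below it. -/
theorem findAux_spec {d : Forest} (hd : d.Wf) {i b : ℕ}
    (hR : ∀ x < d.size, d.rank x ≤ fastGrow i (b + 1)) (fuel x : ℕ)
    (hfuel : d.size ≤ fuel + d.rank x) :
    Compressed d (d.findAux fuel x).2.1 ∧
      (∀ z, d.rank z < d.rank x → (d.findAux fuel x).2.1.parent z = d.parent z) ∧
      ∃ S ⊆ Finset.range (i + 1), (∀ k ∈ S, fastGrow k (d.rank x) ≤ d.rank (d.root x)) ∧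
        (d.findAux fuel x).2.2 + 2 * (d.findAux fuel x).2.1.pot i b ≤
          1 + 2 * d.pot i b + 2 * S.card := by
  have hfst := findAux_fst_eq hd (root_parent hd) (fun _ => root_eq_self hd) fuel x hfuel
  induction fuel generalizing x with
  | zero => exact ⟨⟨rfl, rfl, fun _ => .inl rfl⟩, fun _ _ => rfl, ∅, by simp, by simp, by simp [findAux]⟩
  | succ fuel ih =>
    by_cases hp : d.parent x = x
    · refine ⟨?_, ?_, ∅, by simp, by simp, ?_⟩ <;> simp only [findAux, if_pos hp]
      · exact ⟨rfl, rfl, fun _ => .inl rfl⟩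
      · exact fun _ _ => trivial
      · simp
    have hlt := hd.rank_lt x hp
    have hx := (hd.lt_size x hp).1
    have hfst' := findAux_fst_eq hd (root_parent hd) (fun _ => root_eq_self hd) fuel (d.parent x)
      (by omega)
    obtain ⟨hc, hpar, S, hS, hSr, hpot⟩ := ih (d.parent x) (by omega) hfst'
    simp only [findAux, if_neg hp] at hfst ⊢
    set res := d.findAux fuel (d.parent x) with hres
    rw [hfst]
    rw [root_parent hd] at hSr
    have hrr : d.rank (d.parent x) ≤ d.rank (d.root x) := by
      rw [← root_parent hd]; exact rank_le_rank_root hd _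
    have hresx : res.2.1.parent x = d.parent x := hpar x hlt
    have hroot_ne : d.root x ≠ x := fun h => by
      have := parent_root hd x
      rw [h] at this
      exact hp this
    have hmem : x ∈ Finset.range res.2.1.size := by rw [hc.size_eq]; simpa using hx
    have hsum : ∀ e : Forest, e = { res.2.1 with
        parent := Function.update res.2.1.parent x (d.root x) } →
        e.pot i b + slack i b (d.rank x) (d.rank (d.parent x)) =
          res.2.1.pot i b + slack i b (d.rank x) (d.rank (d.root x)) := by
      rintro e rfl
      unfold pot
      rw [← Finset.add_sum_erase _ _ hmem, ← Finset.add_sum_erase _ _ hmem]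
      have h1 : ∀ y ∈ (Finset.range res.2.1.size).erase x,
          slack i b (res.2.1.rank y) (upRank { res.2.1 with
            parent := Function.update res.2.1.parent x (d.root x) } y) =
          slack i b (res.2.1.rank y) (upRank res.2.1 y) := by
        intro y hy
        have hyx : y ≠ x := (Finset.mem_erase.mp hy).1
        simp [upRank, Function.update_of_ne hyx]
      rw [Finset.sum_congr rfl h1]
      simp only [upRank, hresx, Function.update_self, if_neg hp, if_neg hroot_ne, hc.rank_eq]
      omega
    have hsum := hsum _ rfl
    dsimp only at hsum ⊢
    refine ⟨⟨hc.size_eq, hc.rank_eq, fun y => ?_⟩, fun z hz => ?_, ?_⟩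
    · by_cases hyx : y = x
      · subst hyx
        right
        simp
      · simpa [Function.update_of_ne hyx] using hc.parent_eq y
    · have hzx : z ≠ x := by rintro rfl; exact lt_irrefl _ hz
      simpa [Function.update_of_ne hzx] using hpar z (hz.trans hlt)
    obtain ⟨k, hk, hk1, hk2⟩ := exists_level i _ _ hlt
    -- If `k ∈ S`, the rank of the root is at least `fastGrow k` of the parent's rank, so the
    -- potential drops by at least one; otherwise `k` is added to `S` and covers the two steps.
    by_cases hkS : k ∈ S
    · refine ⟨S, hS, fun k' hk' => (fastGrow_mono k' hlt.le).trans (hSr k' hk'), ?_⟩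
      have := slack_lt hk hk1 hk2 (hSr k hkS) (hR _ (root_lt hd hx))
      omega
    · refine ⟨insert k S, ?_, ?_, ?_⟩
      · intro k' hk'
        rcases Finset.mem_insert.mp hk' with rfl | hk'
        · simpa [Nat.lt_succ_iff] using hk
        · exact hS hk'
      · intro k' hk'
        rcases Finset.mem_insert.mp hk' with rfl | hk'
        · exact hk1.trans hrr
        · exact (fastGrow_mono k' hlt.le).trans (hSr k' hk')
      · rw [Finset.card_insert_of_notMem hkS]
        have := slack_anti i b (d.rank x) hrr
        omega

theorem find_compressed {d : Forest} (hd : d.Wf) (x : ℕ) : Compressed d (d.find x).2.1 :=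
  -- Level 0 and base `d.size` make the rank hypothesis trivial; only the structural part is wanted.
  (findAux_spec hd (i := 0) (b := d.size)
    (fun y hy => (hd.rank_lt_size hy).le.trans (by simp [fastGrow]; omega)) _ x (by omega)).1

theorem find_steps_le {d : Forest} (hd : d.Wf) {i b : ℕ}
    (hR : ∀ x < d.size, d.rank x ≤ fastGrow i (b + 1)) (x : ℕ) :
    (d.find x).2.2 + 2 * (d.find x).2.1.pot i b ≤ 2 * d.pot i b + 3 * (i + 1) := by
  obtain ⟨-, -, S, hS, -, h⟩ := findAux_spec hd hR d.size x (by omega)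
  have := Finset.card_le_card hS
  rw [Finset.card_range] at this
  unfold find
  omega

theorem empty_wf : Forest.empty.Wf := by
  constructor <;> simp [empty]

theorem empty_pot (i b : ℕ) : Forest.empty.pot i b = 0 := by simp [pot, empty]

theorem Wf.parent_size {d : Forest} (h : d.Wf) {x : ℕ} (hx : d.size ≤ x) : d.parent x = x := by
  by_contra hp
  have := (h.lt_size x hp).1
  omega

theorem makeSet_wf {d : Forest} (h : d.Wf) : d.makeSet.Wf where
  lt_size x hx := by
    simp only [makeSet] at hx ⊢
    by_cases hxs : x = d.size
    · simp [hxs] at hx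
    · rw [Function.update_of_ne hxs] at hx ⊢
      have := h.lt_size x hx
      omega
  rank_lt x hx := by
    simp only [makeSet] at hx ⊢
    by_cases hxs : x = d.size
    · simp [hxs] at hx
    · rw [Function.update_of_ne hxs] at hx ⊢
      have h1 := h.lt_size x hx
      rw [Function.update_of_ne hxs, Function.update_of_ne (by omega)]
      exact h.rank_lt x hx
  pow_rank_le x hx := by
    simp only [makeSet] at hx ⊢
    by_cases hxs : x = d.size
    · simp [hxs]
    · rw [Function.update_of_ne hxs]
      have := h.pow_rank_le x (by omega)
      omega
  sum_roots_le := by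
    have := h.sum_roots_le
    rw [Finset.sum_filter] at this ⊢
    simp only [makeSet]
    rw [Finset.sum_range_succ]
    simp only [Function.update_self, if_true, pow_zero]
    refine Nat.add_le_add_right (le_trans (le_of_eq (Finset.sum_congr rfl fun x hx => ?_)) this) 1
    have : x ≠ d.size := by simp at hx; omega
    simp [Function.update_of_ne this]

theorem makeSet_root {d : Forest} (h : d.Wf) (x : ℕ) : d.makeSet.root x = d.root x := by
  refine root_unique (makeSet_wf h) (fun x => ?_) (fun x hx => ?_) x <;> by_cases hxs : x = d.size
  · simp [makeSet, hxs]
  · simp [makeSet, Function.update_of_ne hxs, root_parent h]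
  · rw [hxs]
    exact root_eq_self h (h.parent_size le_rfl)
  · simp only [makeSet, Function.update_of_ne hxs] at hx
    exact root_eq_self h hx

/-- The new root has rank 0 and has all its iterates unreached, so its potential is `slack i b 0 0`.
-/
theorem makeSet_pot {d : Forest} (h : d.Wf) (i b : ℕ) :
    d.makeSet.pot i b = d.pot i b + (i + b + 2) := by
  unfold pot
  simp only [makeSet]
  rw [Finset.sum_range_succ]
  congr 1
  · refine Finset.sum_congr rfl fun x hx => ?_
    have hx : x < d.size := by simpa using hx
    have hp := h.parent_lt hx
    simp [upRank, Function.update_of_ne hx.ne, Function.update_of_ne hp.ne]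
  · simp [upRank, slack_zero]
    omega

/-! ### Union by rank. -/

/-- `e` arises from `d` by linking the root `y` to the root `x`. -/
structure Linked (d e : Forest) (x y : ℕ) : Prop where
  size_eq : e.size = d.size
  parent_eq : e.parent = Function.update d.parent y x
  rank_of_ne : ∀ z, z ≠ x → e.rank z = d.rank z
  rank_eq : e.rank x = d.rank x ∧ d.rank y < d.rank x ∨
    e.rank x = d.rank x + 1 ∧ d.rank y = d.rank x

section Linked
variable {d e : Forest} {x y : ℕ}

theorem Linked.rank_le (h : Linked d e x y) (z : ℕ) : d.rank z ≤ e.rank z := by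
  by_cases hz : z = x
  · subst hz
    rcases h.rank_eq with h | h <;> omega
  · rw [h.rank_of_ne z hz]

theorem Linked.rank_lt (h : Linked d e x y) (hxy : x ≠ y) : e.rank y < e.rank x := by
  rw [h.rank_of_ne y hxy.symm]
  rcases h.rank_eq with h | h <;> omega

/-- The sum of `2 ^ rank` over the roots replaces the sizes of sets. Linking roots of equal rank `r`
merges two terms `2 ^ r` into one `2 ^ (r + 1)`; linking unequal ones drops a term. The bound on the
sum then bounds the increased rank. -/
theorem Linked.wf (hd : d.Wf) (hx : x < d.size) (hy : y < d.size) (hpx : d.parent x = x)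
    (hpy : d.parent y = y) (hxy : x ≠ y) (h : Linked d e x y) : e.Wf := by
  have hsum : ∑ z ∈ Finset.range d.size with d.parent z = z, 2 ^ d.rank z =
      2 ^ d.rank x + (2 ^ d.rank y +
        ∑ z ∈ ((Finset.range d.size).filter (fun z => d.parent z = z)).erase x |>.erase y,
          2 ^ d.rank z) := by
    rw [Finset.add_sum_erase _ (fun z => 2 ^ d.rank z) (a := y) (by simp [hxy.symm, hy, hpy]),
      Finset.add_sum_erase _ (fun z => 2 ^ d.rank z) (a := x) (by simp [hx, hpx])]
  have hle := hd.sum_roots_le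
  constructor
  · intro z hz
    rw [h.parent_eq] at hz ⊢
    rw [h.size_eq]
    by_cases hzy : z = y
    · subst hzy; simp [hx, hy]
    · rw [Function.update_of_ne hzy] at hz ⊢
      exact hd.lt_size z hz
  · intro z hz
    rw [h.parent_eq] at hz ⊢
    by_cases hzy : z = y
    · subst hzy
      simpa using h.rank_lt hxy
    · rw [Function.update_of_ne hzy] at hz ⊢
      have hzx : z ≠ x := by rintro rfl; exact hz hpx
      rw [h.rank_of_ne z hzx]
      exact (hd.rank_lt z hz).trans_le (h.rank_le _)
  · intro z hz
    rw [h.size_eq] at hz ⊢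
    by_cases hzx : z = x
    · subst hzx
      rcases h.rank_eq with h | ⟨h1, h2⟩
      · rw [h.1]; exact hd.pow_rank_le z hz
      · rw [h1, pow_succ]
        rw [hsum, h2] at hle
        omega
    · rw [h.rank_of_ne z hzx]
      exact hd.pow_rank_le z hz
  · rw [h.size_eq]
    have hset : {z ∈ Finset.range d.size | e.parent z = z} =
        ((Finset.range d.size).filter (fun z => d.parent z = z)).erase y := by
      ext z
      simp only [h.parent_eq, Finset.mem_filter, Finset.mem_range, Finset.mem_erase]
      by_cases hzy : z = y
      · subst hzy; simp [hxy]
      · simp [hzy]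
    rw [hset, ← Finset.add_sum_erase _ _ (show x ∈ _ by simp [hxy, hx, hpx]), Finset.erase_right_comm]
    rw [hsum] at hle
    have hrest : ∑ z ∈ ((Finset.range d.size).filter (fun z => d.parent z = z)).erase x |>.erase y,
        2 ^ e.rank z = ∑ z ∈ ((Finset.range d.size).filter (fun z => d.parent z = z)).erase x |>.erase y,
          2 ^ d.rank z := by
      refine Finset.sum_congr rfl fun z hz => ?_
      rw [h.rank_of_ne z (by simp at hz; tauto)]
    rw [hrest]
    rcases h.rank_eq with ⟨h1, h2⟩ | ⟨h1, h2⟩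
    · rw [h1]
      exact le_trans (Nat.add_le_add_left (Nat.le_add_left _ _) _) hle
    · rw [h1, pow_succ]; rw [h2] at hle; omega

theorem Linked.root_eq (hd : d.Wf) (he : e.Wf) (hpx : d.parent x = x) (hpy : d.parent y = y)
    (hxy : x ≠ y) (h : Linked d e x y) (z : ℕ) :
    e.root z = if d.root z = y then x else d.root z := by
  refine root_unique he (f := fun z => if d.root z = y then x else d.root z) (fun z => ?_)
    (fun z hz => ?_) z <;> rw [h.parent_eq] at * <;> by_cases hzy : z = y
  · subst hzy
    simp [root_eq_self hd hpx, root_eq_self hd hpy]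
  · simp [Function.update_of_ne hzy, root_parent hd]
  · subst hzy; simp at hz; exact absurd hz hxy
  · rw [Function.update_of_ne hzy] at hz
    simp [root_eq_self hd hz, hzy]

/-- Only the surviving root can gain: its rank rises by at most one, which adds one iterate on each
of the `i` lower levels. For all other elements the parent's rank can only grow. -/
theorem Linked.pot_le (h : Linked d e x y) (hx : x < d.size) (hpx : d.parent x = x)
    (hpy : d.parent y = y) (hxy : x ≠ y) (i b : ℕ) : e.pot i b ≤ d.pot i b + i := by
  have key : ∀ z ∈ Finset.range d.size, slack i b (e.rank z) (e.upRank z) ≤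
      slack i b (d.rank z) (d.upRank z) + if z = x then i else 0 := by
    intro z _
    by_cases hzx : z = x
    · subst hzx
      have : e.parent z = z := by rw [h.parent_eq, Function.update_of_ne hxy, hpx]
      simp only [upRank, this, hpx, if_true, slack_zero]
      rcases h.rank_eq with h | h <;> rw [h.1]
      · omega
      · rw [Nat.mul_succ i (d.rank z + 1)]; omega
    · rw [if_neg hzx, h.rank_of_ne z hzx, add_zero]
      apply slack_anti
      by_cases hzy : z = y
      · subst hzy; simp [upRank, hpy]
      · simp only [upRank, h.parent_eq, Function.update_of_ne hzy]
        split_ifs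
        · exact le_rfl
        · exact h.rank_le _
  unfold pot
  rw [h.size_eq]
  refine (Finset.sum_le_sum key).trans ?_
  rw [Finset.sum_add_distrib, Finset.sum_ite_eq' (Finset.range d.size) x]
  simp [hx]

end Linked

/-- The effect of a union on a forest: `c` is the new representative. -/
structure Merged (d e : Forest) (x y c : ℕ) : Prop where
  wf : e.Wf
  size_eq : e.size = d.size
  rep : c = d.root x ∨ c = d.root y
  root_eq : ∀ z, e.root z = if d.root z = d.root x ∨ d.root z = d.root y then c else d.root z

/-- The cost consists of two finds, four table steps and twice the gain `i` of a link: `6 * (i + 1)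
+ 4 + 2 * i`. -/
theorem union_spec {d : Forest} (hd : d.Wf) {x y : ℕ} (hx : x < d.size) (hy : y < d.size) :
    Merged d (d.union x y).2.1 x y (d.union x y).1 ∧
      ∀ i b, (∀ z < d.size, d.rank z ≤ fastGrow i (b + 1)) →
        (d.union x y).2.2 + 2 * (d.union x y).2.1.pot i b ≤ 2 * d.pot i b + 12 * (i + 1) := by
  have hc₁ := find_compressed hd x
  have hd₁ := hc₁.wf hd
  have hc₂ := find_compressed hd₁ y
  have hd₂ := hc₂.wf hd₁
  have hr₂ : ∀ z, (((d.find x).2.1.find y).2.1).root z = d.root z := fun z => by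
    rw [hc₂.root_eq hd₁, hc₁.root_eq hd]
  have ha : (d.find x).1 = d.root x := rfl
  have hb : ((d.find x).2.1.find y).1 = d.root y := hc₁.root_eq hd y
  have hsz : ((d.find x).2.1.find y).2.1.size = d.size := hc₂.size_eq.trans hc₁.size_eq
  have hpot : ∀ i b, (∀ z < d.size, d.rank z ≤ fastGrow i (b + 1)) →
      (d.find x).2.2 + ((d.find x).2.1.find y).2.2 + 2 * ((d.find x).2.1.find y).2.1.pot i b ≤
        2 * d.pot i b + 6 * (i + 1) := by
    intro i b hR
    have h1 := find_steps_le hd hR x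
    have h2 := find_steps_le (i := i) (b := b) hd₁
      (by rw [hc₁.size_eq, hc₁.rank_eq]; exact hR) y
    omega
  unfold union
  simp only [ha, hb]
  generalize ((d.find x).2.1.find y).2.1 = e at *
  generalize ((d.find x).2.1.find y).2.2 = c₂ at *
  generalize (d.find x).2.2 = c₁ at *
  have hpa : e.parent (d.root x) = d.root x := by
    have := parent_root hd₂ x
    rwa [hr₂] at this
  have hpb : e.parent (d.root y) = d.root y := by
    have := parent_root hd₂ y
    rwa [hr₂] at this
  have hxa : d.root x < e.size := by rw [hsz]; exact root_lt hd hx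
  have hyb : d.root y < e.size := by rw [hsz]; exact root_lt hd hy
  have link : ∀ {e' : Forest} {a b : ℕ}, (a = d.root x ∧ b = d.root y ∨ a = d.root y ∧ b = d.root x) →
      a ≠ b → Linked e e' a b → Merged d e' x y a ∧
      ∀ i b, (∀ z < d.size, d.rank z ≤ fastGrow i (b + 1)) →
        c₁ + c₂ + 4 + 2 * e'.pot i b ≤ 2 * d.pot i b + 12 * (i + 1) := by
    intro e' a b hab hne hl
    have hab' : a < e.size ∧ b < e.size ∧ e.parent a = a ∧ e.parent b = b := by
      rcases hab with ⟨rfl, rfl⟩ | ⟨rfl, rfl⟩ <;> tauto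
    obtain ⟨h1, h2, h3, h4⟩ := hab'
    have hw := hl.wf hd₂ h1 h2 h3 h4 hne
    refine ⟨⟨hw, hl.size_eq.trans hsz, by tauto, fun z => ?_⟩, fun i b hR => ?_⟩
    · rw [hl.root_eq hd₂ hw h3 h4 hne z, hr₂]
      rcases hab with ⟨rfl, rfl⟩ | ⟨rfl, rfl⟩ <;> grind
    · have := hl.pot_le h1 h3 h4 hne i b
      have := hpot i b hR
      omega
  split_ifs with h1 h2 h3
  · refine ⟨⟨hd₂, hsz, .inl rfl, fun z => ?_⟩, fun i b hR => ?_⟩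
    · rw [hr₂]; grind
    · have := hpot i b hR
      dsimp only
      omega
  · exact link (.inr ⟨rfl, rfl⟩) (Ne.symm h1) ⟨rfl, rfl, fun _ _ => rfl, .inl ⟨rfl, h2⟩⟩
  · exact link (.inl ⟨rfl, rfl⟩) h1 ⟨rfl, rfl, fun _ _ => rfl, .inl ⟨rfl, h3⟩⟩
  · refine link (.inl ⟨rfl, rfl⟩) h1 ⟨rfl, rfl, fun z hz => ?_, .inr ⟨?_, le_antisymm (not_lt.mp h2) (not_lt.mp h3)⟩⟩
    · simp [Function.update_of_ne hz]
    · simp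

end Forest

/-! ### Reasoning about detector operations -/

/-- The result and the final state of `m`, started in state `s`, satisfy `Q`. -/
def Post {β : Type} (m : DetM β) (s : Detector) (Q : β → Detector → Prop) : Prop :=
  Q (m s).1 (m s).2

theorem Post.bind {β γ : Type} {m : DetM β} {f : β → DetM γ} {s : Detector}
    {P : β → Detector → Prop} {Q : γ → Detector → Prop} (h : Post m s P)
    (h' : ∀ a s', P a s' → Post (f a) s' Q) : Post (m >>= f) s Q :=
  h' _ _ h

theorem Post.mono {β : Type} {m : DetM β} {s : Detector} {P Q : β → Detector → Prop}
    (h : Post m s P) (h' : ∀ a s', P a s' → Q a s') : Post m s Q :=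
  h' _ _ h

theorem Post.pure {β : Type} {a : β} {s : Detector} {Q : β → Detector → Prop} (h : Q a s) :
    Post (Pure.pure a) s Q := h

theorem Post.modify {f : Detector → Detector} {s : Detector} {Q : PUnit → Detector → Prop}
    (h : Q ⟨⟩ (f s)) : Post (modify f) s Q := h

/-- The parameters of the analysis: level and base of the potential, a bound for the number of
strands, and a bound for the memory locations. -/
structure Params where
  level : ℕ
  base : ℕ
  strands : ℕ
  locs : ℕ
  log_le : Nat.log 2 strands ≤ fastGrow level (base + 1)

/-- The set of strand `x` in `D_NSP` is attached. -/
def Detector.attached (s : Detector) (x : ℕ) : Bool := (s.att (s.nsp.root x)).isSome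

def Detector.pendingReads (P : Params) (s : Detector) : ℕ :=
  ∑ l ∈ Finset.range P.locs, (s.readers l).length

/-- Steps done so far plus steps prepaid for later. -/
def Detector.debit (P : Params) (s : Detector) : ℕ :=
  s.steps + 2 * (s.sp.pot P.level P.base + s.nsp.pot P.level P.base) +
    17 * (P.level + 1) * s.pendingReads P

/-- Allowance for insertions into `R` and for strands. -/
def Detector.credit (P : Params) (s : Detector) : ℕ :=
  s.insertLog.sum + 4 * P.base * s.nsp.size

structure Detector.Good (s : Detector) : Prop where
  sp_wf : s.sp.Wf
  nsp_wf : s.nsp.Wf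
  size_eq : s.sp.size = s.nsp.size
  rSize_eq : s.rSize = s.insertLog.length
  insertLog_le : ∀ c ∈ s.insertLog, c ≤ 5 * s.insertLog.length + 3

/-- Between `s` and `s'` the detector does `c` units of amortised work, allocates at most `e` strands
and inserts at most `g` nodes into `R`. -/
structure Step (P : Params) (s s' : Detector) (c e g : ℕ) : Prop where
  good : s'.Good
  le_size : s.nsp.size ≤ s'.nsp.size
  size_le : s'.nsp.size ≤ s.nsp.size + e
  log_le : s'.insertLog.length ≤ s.insertLog.length + g
  debit_le : s'.nsp.size ≤ P.strands →
    s'.debit P + s.credit P ≤ s.debit P + s'.credit P + c * (P.level + 1)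

theorem Step.refl {P : Params} {s : Detector} (h : s.Good) : Step P s s 0 0 0 :=
  ⟨h, le_rfl, le_rfl, le_rfl, fun _ => by omega⟩

theorem Step.trans {P : Params} {s s' s'' : Detector} {c e g c' e' g' : ℕ}
    (h : Step P s s' c e g) (h' : Step P s' s'' c' e' g') :
    Step P s s'' (c + c') (e + e') (g + g') := by
  refine ⟨h'.good, h.le_size.trans h'.le_size, ?_, ?_, fun hN => ?_⟩
  · have := h.size_le; have := h'.size_le; omega
  · have := h.log_le; have := h'.log_le; omega
  · have h1 := h.debit_le (h'.le_size.trans hN)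
    have h2 := h'.debit_le hN
    rw [add_mul]
    omega

theorem Step.weaken {P : Params} {s s' : Detector} {c e g c' e' g' : ℕ} (h : Step P s s' c e g)
    (hc : c ≤ c') (he : e ≤ e') (hg : g ≤ g') : Step P s s' c' e' g' := by
  refine ⟨h.good, h.le_size, ?_, ?_, fun hN => (h.debit_le hN).trans ?_⟩
  · have := h.size_le; omega
  · have := h.log_le; omega
  · gcongr

/-- The operation keeps the sets of `D_NSP` and their status, and the recorded readers. -/
structure Keep (s s' : Detector) : Prop where
  root_eq : ∀ x < s.nsp.size, s'.nsp.root x = s.nsp.root x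
  attached_eq : ∀ x < s.nsp.size, s'.attached x = s.attached x
  readers_eq : s'.readers = s.readers

theorem Keep.refl (s : Detector) : Keep s s := ⟨fun _ _ => rfl, fun _ _ => rfl, rfl⟩

structure Quiet (P : Params) (s s' : Detector) (c e g : ℕ) : Prop extends
  Step P s s' c e g, Keep s s'

theorem Quiet.refl {P : Params} {s : Detector} (h : s.Good) : Quiet P s s 0 0 0 :=
  ⟨Step.refl h, Keep.refl s⟩

theorem Quiet.trans {P : Params} {s s' s'' : Detector} {c e g c' e' g' : ℕ}
    (h : Quiet P s s' c e g) (h' : Quiet P s' s'' c' e' g') :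
    Quiet P s s'' (c + c') (e + e') (g + g') := by
  refine ⟨h.toStep.trans h'.toStep, fun x hx => ?_, fun x hx => ?_,
    h'.readers_eq.trans h.readers_eq⟩
  · rw [h'.root_eq x (hx.trans_le h.le_size), h.root_eq x hx]
  · rw [h'.attached_eq x (hx.trans_le h.le_size), h.attached_eq x hx]

theorem Quiet.tail {P : Params} {s s' s'' : Detector} {c e g : ℕ}
    (h : Quiet P s s' c e g) (h' : Quiet P s' s'' 0 0 0) : Quiet P s s'' c e g :=
  h.trans h'

theorem Quiet.weaken {P : Params} {s s' : Detector} {c e g c' e' g' : ℕ} (h : Quiet P s s' c e g)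
    (hc : c ≤ c') (he : e ≤ e') (hg : g ≤ g') : Quiet P s s' c' e' g' :=
  ⟨h.toStep.weaken hc he hg, h.toKeep⟩

/-- The set of `x` has become attached. -/
structure Attach (s s' : Detector) (x : ℕ) : Prop where
  root_eq : ∀ y < s.nsp.size, s'.nsp.root y = s.nsp.root y
  attached_eq : ∀ y < s.nsp.size, s'.attached y =
    (s.attached y || decide (s.nsp.root y = s.nsp.root x))

/-- The set of `y` has been merged into the set of `x`. -/
structure Merge (s s' : Detector) (x y : ℕ) : Prop where
  root_iff : ∀ z < s.nsp.size, ∀ w < s.nsp.size, s'.nsp.root z = s'.nsp.root w ↔ s.nsp.root z = s.nsp.root w ∨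
    (s.nsp.root z = s.nsp.root x ∨ s.nsp.root z = s.nsp.root y) ∧
      (s.nsp.root w = s.nsp.root x ∨ s.nsp.root w = s.nsp.root y)
  attached_eq : ∀ z < s.nsp.size, s'.attached z =
    if s.nsp.root z = s.nsp.root x ∨ s.nsp.root z = s.nsp.root y then s.attached x else s.attached z

theorem Detector.Good.rank_le {P : Params} {f : Forest} (h : f.Wf) (hN : f.size ≤ P.strands) :
    ∀ x < f.size, f.rank x ≤ fastGrow P.level (P.base + 1) := by
  intro x hx
  have h1 := (h.pow_rank_le x hx).trans hN
  exact (Nat.le_log_of_pow_le (by norm_num) h1).trans P.log_le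

/-! ### Amortised costs of the primitive operations. -/

section Primitives
variable {P : Params} {s : Detector}

theorem tick_spec (hs : s.Good) (c : ℕ) : Post (tick c) s fun _ s' => Quiet P s s' c 0 0 := by
  refine ⟨⟨⟨hs.1, hs.2, hs.3, hs.4, hs.5⟩, le_rfl, le_rfl, le_rfl, fun _ => ?_⟩,
    fun _ _ => rfl, fun _ _ => rfl, rfl⟩
  change s.steps + c + _ + _ + s.credit P ≤ s.steps + _ + _ + s.credit P + _
  have := Nat.le_mul_of_pos_right c (Nat.succ_pos P.level)
  simp only [Nat.succ_eq_add_one] at this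
  change s.steps + c + 2 * (s.sp.pot P.level P.base + s.nsp.pot P.level P.base) +
    17 * (P.level + 1) * s.pendingReads P + _ ≤ _
  omega

/-- A change of the tables that do not matter for the analysis. -/
theorem Quiet.of_eq (hs : s.Good) {s' : Detector} (h1 : s'.sp = s.sp) (h2 : s'.nsp = s.nsp)
    (h3 : s'.att = s.att) (h4 : s'.rSize = s.rSize) (h5 : s'.insertLog = s.insertLog)
    (h6 : s'.readers = s.readers) (h7 : s'.steps = s.steps) : Quiet P s s' 0 0 0 := by
  refine ⟨⟨⟨h1 ▸ hs.1, h2 ▸ hs.2, ?_, ?_, ?_⟩, ?_, ?_, ?_, fun _ => ?_⟩,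
    fun _ _ => ?_, fun _ _ => ?_, h6⟩
  · rw [h1, h2]; exact hs.3
  · rw [h4, h5]; exact hs.4
  · rw [h5]; exact hs.5
  · rw [h2]
  · rw [h2]; exact le_rfl
  · rw [h5]; exact le_rfl
  · simp [Detector.debit, Detector.credit, Detector.pendingReads, h1, h2, h5, h6, h7]
  · rw [h2]
  · simp [Detector.attached, h2, h3]

theorem findSP_spec (hs : s.Good) (x : ℕ) :
    Post (findSP x) s fun _ s' => Quiet P s s' 3 0 0 := by
  have hc := Forest.find_compressed hs.sp_wf x
  refine ⟨⟨⟨hc.wf hs.1, hs.2, hc.size_eq.trans hs.3, hs.4, hs.5⟩, le_rfl, le_rfl, le_rfl,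
    fun hN => ?_⟩, fun _ _ => rfl, fun _ _ => rfl, rfl⟩
  have h := Forest.find_steps_le hs.1 (i := P.level) (b := P.base)
    (Detector.Good.rank_le hs.1 (by rw [hs.3]; exact hN)) x
  change s.steps + (s.sp.find x).2.2 +
    2 * ((s.sp.find x).2.1.pot P.level P.base + s.nsp.pot P.level P.base) +
    17 * (P.level + 1) * s.pendingReads P + s.credit P ≤ s.steps +
    2 * (s.sp.pot P.level P.base + s.nsp.pot P.level P.base) +
    17 * (P.level + 1) * s.pendingReads P + s.credit P + 3 * (P.level + 1)
  omega

theorem findNSP_spec (hs : s.Good) (x : ℕ) :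
    Post (findNSP x) s fun r s' => Quiet P s s' 3 0 0 ∧ r = s.nsp.root x ∧
      s'.att = s.att ∧ ∀ y, s'.nsp.root y = s.nsp.root y := by
  have hc := Forest.find_compressed hs.nsp_wf x
  have hroot := hc.root_eq hs.nsp_wf
  refine ⟨⟨⟨⟨hs.1, hc.wf hs.2, hs.3.trans hc.size_eq.symm, hs.4, hs.5⟩, hc.size_eq.ge, hc.size_eq.le,
    le_rfl, fun hN => ?_⟩, fun y _ => hroot y, fun y _ => ?_, rfl⟩, rfl, rfl, hroot⟩
  · have h := Forest.find_steps_le hs.2 (i := P.level) (b := P.base)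
      (Detector.Good.rank_le hs.2 (by rw [← hc.size_eq]; exact hN)) x
    change s.steps + (s.nsp.find x).2.2 +
      2 * (s.sp.pot P.level P.base + (s.nsp.find x).2.1.pot P.level P.base) +
      17 * (P.level + 1) * s.pendingReads P + s.credit P ≤ s.steps +
      2 * (s.sp.pot P.level P.base + s.nsp.pot P.level P.base) +
      17 * (P.level + 1) * s.pendingReads P +
      (s.insertLog.sum + 4 * P.base * (s.nsp.find x).2.1.size) + 3 * (P.level + 1)
    rw [hc.size_eq]
    unfold Detector.credit
    omega
  · change (s.att ((s.nsp.find x).2.1.root y)).isSome = _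
    rw [hroot]
    rfl

/-- Two new elements raise the doubled potential by `4 * (level + base + 2)`. The part `4 * base`
goes to `credit`; the rest and the 10 steps fit into `18 * (level + 1)`. -/
theorem newStrand_spec (hs : s.Good) :
    Post newStrand s fun x s' => Quiet P s s' 18 1 0 ∧ x < s'.nsp.size ∧
      s'.attached x = false ∧ ∀ y < s.nsp.size, s'.nsp.root y ≠ s'.nsp.root x := by
  have hroot := Forest.makeSet_root hs.nsp_wf
  have hself : s.nsp.root s.nsp.size = s.nsp.size :=
    Forest.root_eq_self hs.nsp_wf (hs.nsp_wf.parent_size le_rfl)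
  have hne : ∀ y < s.nsp.size, s.nsp.root y ≠ s.nsp.size :=
    fun y hy => (Forest.root_lt hs.nsp_wf hy).ne
  refine ⟨⟨⟨⟨Forest.makeSet_wf hs.1, Forest.makeSet_wf hs.2, congrArg (· + 1) hs.3, hs.4, hs.5⟩,
    Nat.le_succ _, le_rfl, le_rfl, fun _ => ?_⟩, fun y _ => hroot y, fun y hy => ?_, rfl⟩,
    Nat.lt_succ_self _, ?_, fun y hy => ?_⟩
  · change s.steps + 10 + 2 * (s.sp.makeSet.pot P.level P.base + s.nsp.makeSet.pot P.level P.base) +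
      17 * (P.level + 1) * s.pendingReads P + (s.insertLog.sum + 4 * P.base * s.nsp.size) ≤
      s.steps + 2 * (s.sp.pot P.level P.base + s.nsp.pot P.level P.base) +
      17 * (P.level + 1) * s.pendingReads P +
      (s.insertLog.sum + 4 * P.base * (s.nsp.size + 1)) + 18 * (P.level + 1)
    rw [Forest.makeSet_pot hs.1, Forest.makeSet_pot hs.2, Nat.mul_succ (4 * P.base)]
    omega
  · change (Function.update s.att s.nsp.size none (s.nsp.makeSet.root y)).isSome = _
    rw [hroot, Function.update_of_ne (hne y hy)]
    rfl
  · change (Function.update s.att s.nsp.size none (s.nsp.makeSet.root s.nsp.size)).isSome = _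
    rw [hroot, hself]
    simp
  · change s.nsp.makeSet.root y ≠ s.nsp.makeSet.root s.nsp.size
    rw [hroot, hroot, hself]
    exact hne y hy

theorem unionSP_spec (hs : s.Good) {x y : ℕ} (hx : x < s.nsp.size) (hy : y < s.nsp.size) :
    Post (unionSP x y) s fun _ s' => Quiet P s s' 13 0 0 := by
  rw [← hs.size_eq] at hx hy
  obtain ⟨hm, hpot⟩ := Forest.union_spec hs.sp_wf hx hy
  refine ⟨⟨⟨hm.wf, hs.2, hm.size_eq.trans hs.3, hs.4, hs.5⟩, le_rfl, le_rfl, le_rfl,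
    fun hN => ?_⟩, fun _ _ => rfl, fun _ _ => rfl, rfl⟩
  have h := hpot P.level P.base (Detector.Good.rank_le hs.1 (by rw [hs.3]; exact hN))
  change s.steps + 1 + (s.sp.union x y).2.2 +
    2 * ((s.sp.union x y).2.1.pot P.level P.base + s.nsp.pot P.level P.base) +
    17 * (P.level + 1) * s.pendingReads P + s.credit P ≤ s.steps +
    2 * (s.sp.pot P.level P.base + s.nsp.pot P.level P.base) +
    17 * (P.level + 1) * s.pendingReads P + s.credit P + 13 * (P.level + 1)
  omega

theorem toP_spec (hs : s.Good) (x : ℕ) : Post (toP x) s fun _ s' => Quiet P s s' 4 0 0 := by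
  refine Post.bind (tick_spec (P := P) hs 1) fun _ s₁ h₁ => ?_
  refine Post.bind (findSP_spec (P := P) h₁.good x) fun r s₂ h₂ => ?_
  exact Post.modify ((h₁.trans h₂).tail (Quiet.of_eq h₂.good rfl rfl rfl rfl rfl rfl rfl))

theorem unionNSP_spec (hs : s.Good) {x y : ℕ} (hx : x < s.nsp.size) (hy : y < s.nsp.size) :
    Post (unionNSP x y) s fun _ s' => Step P s s' 21 0 0 ∧ Merge s s' x y := by
  refine Post.bind (tick_spec (P := P) hs 6) fun _ s₁ h₁ => ?_
  refine Post.bind (findNSP_spec (P := P) h₁.good x) ?_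
  rintro a s₂ ⟨h₂, rfl, hatt, hroot⟩
  have h₁₂ := h₁.trans h₂
  have hs₂ := h₂.good
  have hx₂ := hx.trans_le h₁₂.le_size
  have hy₂ := hy.trans_le h₁₂.le_size
  obtain ⟨hm, hpot⟩ := Forest.union_spec hs₂.nsp_wf hx₂ hy₂
  rw [← hroot x]
  refine ⟨(h₁₂.toStep.trans (s'' := _) (c' := 12) (e' := 0) (g' := 0)
    ⟨⟨hs₂.1, hm.wf, hs₂.3.trans hm.size_eq.symm, hs₂.4, hs₂.5⟩, hm.size_eq.ge, hm.size_eq.le, le_rfl,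
      fun hN => ?_⟩), fun z hz w hw => ?_, fun z hz => ?_⟩
  · have h := hpot P.level P.base (Detector.Good.rank_le hs₂.2 (by rw [← hm.size_eq]; exact hN))
    change s₂.steps + (s₂.nsp.union x y).2.2 +
      2 * (s₂.sp.pot P.level P.base + (s₂.nsp.union x y).2.1.pot P.level P.base) +
      17 * (P.level + 1) * s₂.pendingReads P + s₂.credit P ≤ s₂.steps +
      2 * (s₂.sp.pot P.level P.base + s₂.nsp.pot P.level P.base) +
      17 * (P.level + 1) * s₂.pendingReads P +
      (s₂.insertLog.sum + 4 * P.base * (s₂.nsp.union x y).2.1.size) + 12 * (P.level + 1)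
    rw [hm.size_eq]
    unfold Detector.credit
    omega
  · change (s₂.nsp.union x y).2.1.root z = (s₂.nsp.union x y).2.1.root w ↔ _
    rw [← h₁₂.root_eq z hz, ← h₁₂.root_eq w hw, ← h₁₂.root_eq x hx, ← h₁₂.root_eq y hy, hm.root_eq,
      hm.root_eq]
    have := hm.rep
    grind
  · change (Function.update s₂.att (s₂.nsp.union x y).1 (s₂.att (s₂.nsp.root x))
      ((s₂.nsp.union x y).2.1.root z)).isSome = _
    rw [← h₁₂.root_eq z hz, ← h₁₂.root_eq x hx, ← h₁₂.root_eq y hy, hm.root_eq,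
      ← h₁₂.attached_eq z hz, ← h₁₂.attached_eq x hx]
    split_ifs with h
    · rw [Function.update_self]
      rfl
    · rw [Function.update_of_ne]
      · rfl
      · have := hm.rep
        grind

theorem attachedSet_spec (hs : s.Good) (x : ℕ) : Post (attachedSet x) s fun r s' =>
    Quiet P s s' 4 0 0 ∧ (x < s.nsp.size → r.isSome = s.attached x) := by
  refine Post.bind (tick_spec (P := P) hs 1) fun _ s₁ h₁ => ?_
  refine Post.bind (findNSP_spec (P := P) h₁.good x) ?_
  rintro r s₂ ⟨h₂, rfl, hatt, hroot⟩
  refine ⟨h₁.trans h₂, fun hx => ?_⟩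
  rw [← (h₁.trans h₂).attached_eq x hx]
  change (s₂.att (s₁.nsp.root x)).isSome = (s₂.att (s₂.nsp.root x)).isSome
  rw [hroot]

theorem predProxy_spec (hs : s.Good) (x : ℕ) :
    Post (predProxy x) s fun _ s' => Quiet P s s' 5 0 0 := by
  refine Post.bind (tick_spec (P := P) hs 2) fun _ s₁ h₁ => ?_
  refine Post.bind (findNSP_spec (P := P) h₁.good x) fun r s₂ h₂ => ?_
  exact h₁.trans h₂.1

theorem succProxy_spec (hs : s.Good) (x : ℕ) :
    Post (succProxy x) s fun _ s' => Quiet P s s' 5 0 0 := by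
  refine Post.bind (tick_spec (P := P) hs 2) fun _ s₁ h₁ => ?_
  refine Post.bind (findNSP_spec (P := P) h₁.good x) fun r s₂ h₂ => ?_
  exact h₁.trans h₂.1

theorem setAttPred_spec (hs : s.Good) (x a : ℕ) :
    Post (setAttPred x a) s fun _ s' => Quiet P s s' 4 0 0 := by
  refine Post.bind (tick_spec (P := P) hs 1) fun _ s₁ h₁ => ?_
  refine Post.bind (findNSP_spec (P := P) h₁.good x) fun r s₂ h₂ => ?_
  exact Post.modify ((h₁.trans h₂.1).tail (Quiet.of_eq h₂.1.good rfl rfl rfl rfl rfl rfl rfl))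

theorem setAttSucc_spec (hs : s.Good) (x a : ℕ) :
    Post (setAttSucc x a) s fun _ s' => Quiet P s s' 4 0 0 := by
  refine Post.bind (tick_spec (P := P) hs 1) fun _ s₁ h₁ => ?_
  refine Post.bind (findNSP_spec (P := P) h₁.good x) fun r s₂ h₂ => ?_
  exact Post.modify ((h₁.trans h₂.1).tail (Quiet.of_eq h₂.1.good rfl rfl rfl rfl rfl rfl rfl))

theorem readR_spec (hs : s.Good) (a b : ℕ) :
    Post (readR a b) s fun _ s' => Quiet P s s' 1 0 0 :=
  Post.bind (tick_spec (P := P) hs 1) fun _ _ h₁ => h₁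

theorem setAttached_spec (hs : s.Good) {x : ℕ} (hx : x < s.nsp.size) (a : ℕ) :
    Post (setAttached x a) s fun _ s' => Step P s s' 4 0 0 ∧ Attach s s' x := by
  refine Post.bind (tick_spec (P := P) hs 1) fun _ s₁ h₁ => ?_
  refine Post.bind (findNSP_spec (P := P) h₁.good x) ?_
  rintro r s₂ ⟨h₂, rfl, hatt, hroot⟩
  have h₁₂ := h₁.trans h₂
  have hs₂ := h₂.good
  refine Post.modify ⟨h₁₂.toStep.trans (c' := 0) (e' := 0) (g' := 0)
    ⟨⟨hs₂.1, hs₂.2, hs₂.3, hs₂.4, hs₂.5⟩, le_rfl, le_rfl, le_rfl, fun _ => ?_⟩,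
    h₁₂.root_eq, fun y hy => ?_⟩
  · rw [zero_mul, add_zero]; exact le_rfl
  · change (Function.update s₂.att (s₁.nsp.root x) (some a) (s₂.nsp.root y)).isSome = _
    rw [← hroot x, ← h₁₂.attached_eq y hy, ← h₁₂.root_eq y hy, ← h₁₂.root_eq x hx]
    by_cases h : s₂.nsp.root y = s₂.nsp.root x
    · simp [h]
    · simp [h, Detector.attached]

/-! ### Insertion into the reachability structure -/

theorem reachesAny_spec (y : ℕ) (ps : List ℕ) (s : Detector) :
    Post (reachesAny y ps) s fun _ s' => s' = { s with steps := s.steps + ps.length } := by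
  induction ps generalizing s with
  | nil => rfl
  | cons p ps ih =>
    refine (ih { s with steps := s.steps + 1 }).trans ?_
    rw [List.length_cons]
    congr 1
    exact Nat.add_right_comm _ _ _

theorem reachedFromAny_spec (y : ℕ) (ps : List ℕ) (s : Detector) :
    Post (reachedFromAny y ps) s fun _ s' => s' = { s with steps := s.steps + ps.length } := by
  induction ps generalizing s with
  | nil => rfl
  | cons p ps ih =>
    refine (ih { s with steps := s.steps + 1 }).trans ?_
    rw [List.length_cons]
    congr 1
    exact Nat.add_right_comm _ _ _

theorem fillR_spec (x : ℕ) (ps qs : List ℕ) (y : ℕ) (s : Detector) :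
    Post (fillR x ps qs y) s fun _ s' => ∃ R, s' = { s with
      steps := s.steps + y * (ps.length + qs.length + 2), reach := R } := by
  induction y generalizing s with
  | zero => exact ⟨s.reach, by simp; rfl⟩
  | succ y ih =>
    refine Post.bind (reachesAny_spec y ps s) ?_
    rintro b _ rfl
    refine Post.bind (P := fun _ s' => ∃ R, s' = { s with
      steps := s.steps + ps.length + 1, reach := R }) ⟨_, rfl⟩ ?_
    rintro _ _ ⟨R, rfl⟩
    refine Post.bind (reachedFromAny_spec y qs _) ?_
    rintro c _ rfl
    refine Post.bind (P := fun _ s' => ∃ R, s' = { s with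
      steps := s.steps + ps.length + 1 + qs.length + 1, reach := R }) ⟨_, rfl⟩ ?_
    rintro _ _ ⟨R', rfl⟩
    refine (ih _).mono ?_
    rintro _ _ ⟨R'', rfl⟩
    refine ⟨R'', ?_⟩
    congr 1
    ring

/-- The amortised cost is 0 because the steps are recorded in `insertLog`, so `debit` and `credit`
rise by the same amount. The step count is exact, since the scans of neighbours never stop early. -/
theorem insertR_spec (hs : s.Good) {ps qs : List ℕ} (h : ps.length + qs.length ≤ 3) :
    Post (insertR ps qs) s fun _ s' => Quiet P s s' 0 0 1 := by
  have key : ∃ R v, (insertR ps qs) s = (v, { s with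
      steps := s.steps + (s.rSize * (ps.length + qs.length + 2) + 3)
      reach := R
      rSize := s.rSize + 1
      insertLog := (s.rSize * (ps.length + qs.length + 2) + 3) :: s.insertLog }) := by
    obtain ⟨R, hR⟩ := fillR_spec s.rSize ps qs s.rSize { s with steps := s.steps + 2 }
    refine ⟨Function.update R s.rSize (Function.update (R s.rSize) s.rSize false), s.rSize, ?_⟩
    have : (insertR ps qs) s = (s.rSize,
      (fun t : Detector => { t with
        reach := Function.update t.reach s.rSize (Function.update (t.reach s.rSize) s.rSize false)
        steps := t.steps + 1
        rSize := s.rSize + 1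
        insertLog := (t.steps + 1 - s.steps) :: t.insertLog })
        (fillR s.rSize ps qs s.rSize { s with steps := s.steps + 2 }).2) := rfl
    rw [this, hR]
    dsimp only
    have e : s.steps + 2 + s.rSize * (ps.length + qs.length + 2) + 1 =
      s.steps + (s.rSize * (ps.length + qs.length + 2) + 3) := by omega
    rw [e, Nat.add_sub_cancel_left]
  obtain ⟨R, v, key⟩ := key
  unfold Post
  rw [key]
  -- For each old node: at most three reads, one per neighbour, and two writes.
  have hle : s.rSize * (ps.length + qs.length + 2) ≤ s.rSize * 5 := Nat.mul_le_mul_left _ (by omega)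
  have hr := hs.rSize_eq
  refine ⟨⟨⟨hs.1, hs.2, hs.3, congrArg (· + 1) hs.4, ?_⟩, le_rfl, le_rfl, le_rfl, fun _ => ?_⟩,
    fun _ _ => rfl, fun _ _ => rfl, rfl⟩
  · intro c hc
    simp only [List.length_cons]
    rcases List.mem_cons.mp hc with rfl | hc
    · omega
    · have := hs.insertLog_le c hc
      omega
  · simp only [Detector.debit, Detector.credit, Detector.pendingReads, List.sum_cons]
    omega

theorem Quiet.attach {s' s'' : Detector} {c e g c' e' g' x : ℕ} (h : Quiet P s s' c e g)
    (hx : x < s.nsp.size) (h' : Step P s' s'' c' e' g' ∧ Attach s' s'' x) :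
    Step P s s'' (c + c') (e + e') (g + g') ∧ Attach s s'' x := by
  refine ⟨h.toStep.trans h'.1, fun y hy => ?_, fun y hy => ?_⟩
  · rw [h'.2.root_eq y (hy.trans_le h.le_size), h.root_eq y hy]
  · rw [h'.2.attached_eq y (hy.trans_le h.le_size), h.root_eq y hy, h.root_eq x hx,
      h.attached_eq y hy]

theorem attachify_spec (hs : s.Good) {x : ℕ} (hx : x < s.nsp.size) {qs : List ℕ}
    (h : qs.length ≤ 2) :
    Post (attachify x qs) s fun _ s' => Step P s s' 13 0 1 ∧ Attach s s' x := by
  refine Post.bind (attachedSet_spec (P := P) hs x) ?_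
  rintro (_ | a) s₁ ⟨h₁, ha⟩
  · refine Post.bind (predProxy_spec (P := P) h₁.good x) fun p s₂ h₂ => ?_
    refine Post.bind (insertR_spec (P := P) h₂.good (by simp; omega)) fun a s₃ h₃ => ?_
    have h₁₃ := (h₁.trans h₂).trans h₃
    refine Post.bind (setAttached_spec (P := P) h₃.good (hx.trans_le h₁₃.le_size) a)
      fun _ s₄ h₄ => ?_
    exact h₁₃.attach hx h₄
  · refine Post.pure ⟨h₁.toStep.weaken (by omega) (by omega) (by omega), h₁.root_eq, fun y hy => ?_⟩
    rw [h₁.attached_eq y hy]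
    by_cases hr : s.nsp.root y = s.nsp.root x
    · have : s.attached y = true := by
        rw [Detector.attached, hr]; exact (ha hx).symm
      simp [this]
    · simp [hr]

theorem attachNew_spec (hs : s.Good) {x : ℕ} (hx : x < s.nsp.size) {ps : List ℕ}
    (h : ps.length ≤ 2) :
    Post (attachNew x ps) s fun _ s' => Step P s s' 4 0 1 ∧ Attach s s' x := by
  refine Post.bind (insertR_spec (P := P) hs (by simp; omega)) fun a s₁ h₁ => ?_
  refine (setAttached_spec (P := P) h₁.good (hx.trans_le h₁.le_size) a).mono fun _ s₂ h₂ => ?_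
  simpa using h₁.attach hx h₂

end Primitives

/-! ### Live strands -/

/-- The strands of `A` exist, and those in unattached sets are in different sets. -/
structure Live (s : Detector) (A : List ℕ) : Prop where
  lt : ∀ x ∈ A, x < s.nsp.size
  distinct : A.Pairwise fun x y => s.nsp.root x = s.nsp.root y → s.attached x = true

/-- The number of strands of `A` in attached sets. -/
def Detector.count (s : Detector) (A : List ℕ) : ℕ := A.countP s.attached

section Live
variable {P : Params} {s s' : Detector} {A B : List ℕ} {x y c e g : ℕ}

theorem attached_congr (h : s.nsp.root x = s.nsp.root y) : s.attached x = s.attached y := by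
  rw [Detector.attached, h, Detector.attached]

theorem count_congr (h : ∀ x ∈ A, s'.attached x = s.attached x) : s'.count A = s.count A :=
  List.countP_congr fun x hx => by rw [h x hx]

theorem count_cons (s : Detector) (x : ℕ) (A : List ℕ) :
    s.count (x :: A) = s.count A + if s.attached x then 1 else 0 := by
  simp [Detector.count, List.countP_cons]

theorem Live.perm (h : Live s A) (hp : A.Perm B) : Live s B :=
  ⟨fun x hx => h.lt x (hp.mem_iff.2 hx), h.distinct.perm hp fun {x y} hxy he => by
    rw [attached_congr he]; exact hxy he.symm⟩

theorem Live.tail (h : Live s (x :: A)) : Live s A :=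
  ⟨fun y hy => h.lt y (List.mem_cons_of_mem _ hy), h.distinct.tail⟩

theorem Live.ne_of_unattached (h : Live s (x :: A)) (hx : s.attached x = false) :
    ∀ y ∈ A, s.nsp.root y ≠ s.nsp.root x := fun y hy he => by
  have := (List.pairwise_cons.1 h.distinct).1 y hy he.symm
  rw [hx] at this
  exact Bool.false_ne_true this

theorem Quiet.live (hq : Quiet P s s' c e g) (h : Live s A) : Live s' A :=
  ⟨fun x hx => (h.lt x hx).trans_le hq.le_size, h.distinct.imp_of_mem fun {x y} hx hy hxy he => by
    rw [hq.root_eq x (h.lt x hx), hq.root_eq y (h.lt y hy)] at he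
    rw [hq.attached_eq x (h.lt x hx)]
    exact hxy he⟩

theorem Quiet.count (hq : Quiet P s s' c e g) (h : Live s A) : s'.count A = s.count A :=
  count_congr fun x hx => hq.attached_eq x (h.lt x hx)

theorem Live.cons_new (h : Live s' A) (hA : ∀ y ∈ A, s'.nsp.root y ≠ s'.nsp.root x)
    (hx : x < s'.nsp.size) : Live s' (x :: A) :=
  ⟨fun y hy => by
    rcases List.mem_cons.1 hy with rfl | hy
    · exact hx
    · exact h.lt y hy,
  List.pairwise_cons.2 ⟨fun y hy he => absurd he.symm (hA y hy), h.distinct⟩⟩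

/-- A live strand that shares the set of `x` was attached already, by distinctness; so at most `x`
itself changes its status. -/
theorem Live.attach (h : Live s (x :: A)) (ha : Attach s s' x) (hsz : s.nsp.size ≤ s'.nsp.size) :
    Live s' (x :: A) ∧ s'.attached x = true ∧ ∀ y ∈ A, s'.attached y = s.attached y := by
  have hx : x < s.nsp.size := h.lt x List.mem_cons_self
  refine ⟨⟨fun y hy => (h.lt y hy).trans_le hsz, h.distinct.imp_of_mem fun {y z} hy hz hyz he => ?_⟩,
    ?_, fun y hy => ?_⟩
  · rw [ha.root_eq y (h.lt y hy), ha.root_eq z (h.lt z hz)] at he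
    rw [ha.attached_eq y (h.lt y hy), hyz he, Bool.true_or]
  · rw [ha.attached_eq x hx]
    simp
  · have hy' := h.lt y (List.mem_cons_of_mem _ hy)
    rw [ha.attached_eq y hy']
    by_cases he : s.nsp.root y = s.nsp.root x
    · have := (List.pairwise_cons.1 h.distinct).1 y hy he.symm
      rw [attached_congr he, this]
      simp
    · simp [he]

/-- No other live strand is in the unattached set of `y`. Hence the merged set contains only those
strands of `A` that were in the set of `x`, and these keep its status. -/
theorem Live.merge (h : Live s (y :: A)) (hy : s.attached y = false)
    (hm : Merge s s' x y) (hsz : s.nsp.size ≤ s'.nsp.size) :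
    Live s' A ∧ ∀ z ∈ A, s'.attached z = s.attached z := by
  have hne := h.ne_of_unattached hy
  have hatt : ∀ z ∈ A, s'.attached z = s.attached z := by
    intro z hz
    rw [hm.attached_eq z (h.tail.lt z hz)]
    split_ifs with hc
    · exact (attached_congr (hc.resolve_right (hne z hz))).symm
    · rfl
  refine ⟨⟨fun z hz => (h.tail.lt z hz).trans_le hsz,
    h.tail.distinct.imp_of_mem fun {z w} hz hw hzw he => ?_⟩, hatt⟩
  rw [hatt z hz]
  rw [hm.root_iff z (h.tail.lt z hz) w (h.tail.lt w hw)] at he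
  rcases he with he | ⟨h1, h2⟩
  · exact hzw he
  · exact hzw ((h1.resolve_right (hne z hz)).trans (h2.resolve_right (hne w hw)).symm)

theorem Live.replace (h : Live s (x :: A)) (he : s.nsp.root y = s.nsp.root x)
    (hy : y < s.nsp.size) : Live s (y :: A) :=
  ⟨fun z hz => by
    rcases List.mem_cons.1 hz with rfl | hz
    · exact hy
    · exact h.tail.lt z hz,
  List.pairwise_cons.2 ⟨fun z hz hr => by
    rw [attached_congr he]
    exact (List.pairwise_cons.1 h.distinct).1 z hz (he.symm.trans hr), h.tail.distinct⟩⟩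

/-- Merging a new strand `y` into the set of the live strand `x`, which it replaces. -/
theorem Live.merge_new (h : Live s (y :: x :: A)) (hy : s.attached y = false)
    (hm : Merge s s' x y) (hsz : s.nsp.size ≤ s'.nsp.size) :
    Live s' (y :: A) ∧ s'.attached y = s.attached x ∧ ∀ z ∈ A, s'.attached z = s.attached z := by
  have hx : x < s.nsp.size := h.lt x (by simp)
  have hy' : y < s.nsp.size := h.lt y (by simp)
  obtain ⟨h1, h2⟩ := h.merge hy hm hsz
  refine ⟨h1.replace ?_ (hy'.trans_le hsz), ?_, fun z hz => h2 z (List.mem_cons_of_mem _ hz)⟩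
  · exact (hm.root_iff y hy' x hx).2 (.inr ⟨.inr rfl, .inl rfl⟩)
  · rw [hm.attached_eq y hy', if_pos (.inr rfl)]

theorem newStrand_live (hs : s.Good) (h : Live s A) :
    Post newStrand s fun x s' => Quiet P s s' 18 1 0 ∧ Live s' (x :: A) ∧ s'.attached x = false :=
  (newStrand_spec (P := P) hs).mono fun _ _ h' =>
    ⟨h'.1, Live.cons_new (h'.1.live h) (fun y hy => h'.2.2.2 y (h.lt y hy)) h'.2.1, h'.2.2.1⟩

end Live

/-! ### Joining one child. -/

section Join
variable {P : Params} {s : Detector} {A : List ℕ} {f j t o c : ℕ}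

/-- The two last strands `o` and `t` disappear into the set of the fork `f`, and `j` takes over the
place and the status of `f`. -/
theorem join_unattached_spec (hs : s.Good) (hl : Live s (j :: t :: f :: o :: A))
    (hj : s.attached j = false) (ht : s.attached t = false) (ho : s.attached o = false) :
    Post (do unionNSP f o; unionNSP f t; unionNSP f j; return j) s fun j' s' =>
      Step P s s' 63 0 0 ∧ Live s' (j' :: A) ∧ s'.count (j' :: A) = s.count (f :: A) := by
  refine Post.bind (unionNSP_spec (P := P) hs (hl.lt f (by simp)) (hl.lt o (by simp))) ?_
  rintro _ s₁ ⟨h₁, hm₁⟩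
  obtain ⟨hl₁, hc₁⟩ := (hl.perm (B := o :: t :: j :: f :: A) (by grind)).merge
    ho hm₁ h₁.le_size
  refine Post.bind (unionNSP_spec (P := P) h₁.good (hl₁.lt f (by simp)) (hl₁.lt t (by simp))) ?_
  rintro _ s₂ ⟨h₂, hm₂⟩
  obtain ⟨hl₂, hc₂⟩ := hl₁.merge (by rw [hc₁ t (by simp), ht]) hm₂ h₂.le_size
  refine Post.bind (unionNSP_spec (P := P) h₂.good (hl₂.lt f (by simp)) (hl₂.lt j (by simp))) ?_
  rintro _ s₃ ⟨h₃, hm₃⟩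
  obtain ⟨hl₃, hj₃, hc₃⟩ := hl₂.merge_new (by rw [hc₂ j (by simp), hc₁ j (by simp), hj]) hm₃ h₃.le_size
  refine Post.pure ⟨(h₁.trans h₂).trans h₃, hl₃, ?_⟩
  rw [count_cons, count_cons, hj₃, hc₂ f (by simp), hc₁ f (by simp)]
  congr 1
  refine count_congr fun z hz => ?_
  rw [hc₃ z hz, hc₂ z (by simp [hz]), hc₁ z (by simp [hz])]

/-- Here `t` is the attached last strand, whichever branch it ends, `c` the first strand of that
branch and `o` the other last strand. No node is inserted, and `j` replaces `t` as an attached live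
strand; the fork leaves the list, so its merge affects nothing else. -/
theorem join_mixed_spec (hs : s.Good) (hl : Live s (j :: t :: f :: A)) (hc : c < s.nsp.size)
    (hj : s.attached j = false) (ht : s.attached t = true) (a : ℕ) :
    Post (do
      if (← attachedSet f).isNone then unionNSP c f
      unionNSP t j
      setAttSucc o a
      return j) s fun j' s' =>
      Step P s s' 50 0 0 ∧ Live s' (j' :: A) ∧ s'.count (j' :: A) = s.count A + 1 := by
  refine Post.bind (attachedSet_spec (P := P) hs f) ?_
  rintro r s₁ ⟨h₁, hr⟩
  replace hr := hr (hl.lt f (by simp))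
  have rest : ∀ s₂, Step P s s₂ 25 0 0 → Live s₂ (j :: t :: A) →
      (∀ z ∈ j :: t :: A, s₂.attached z = s.attached z) →
      Post (do unionNSP t j; setAttSucc o a; return j) s₂ fun j' s' =>
        Step P s s' 50 0 0 ∧ Live s' (j' :: A) ∧ s'.count (j' :: A) = s.count A + 1 := by
    intro s₂ h₂ hl₂ hc₂
    refine Post.bind (unionNSP_spec (P := P) h₂.good (hl₂.lt t (by simp)) (hl₂.lt j (by simp))) ?_
    rintro _ s₃ ⟨h₃, hm₃⟩
    obtain ⟨hl₃, hj₃, hc₃⟩ := hl₂.merge_new (by rw [hc₂ j (by simp), hj]) hm₃ h₃.le_size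
    refine Post.bind (setAttSucc_spec (P := P) h₃.good o a) fun _ s₄ h₄ => ?_
    refine Post.pure ⟨(h₂.trans h₃).trans h₄.toStep, h₄.live hl₃, ?_⟩
    rw [h₄.count hl₃, count_cons, hj₃, hc₂ t (by simp), ht, if_pos rfl]
    congr 1
    refine count_congr fun z hz => ?_
    rw [hc₃ z hz, hc₂ z (by simp [hz])]
  have hl₁ := h₁.live hl
  dsimp only
  split_ifs with hn
  · have hf : s₁.attached f = false := by
      rw [h₁.attached_eq f (hl.lt f (by simp)), ← hr]
      simpa using hn
    have hc₁ := hc.trans_le h₁.le_size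
    refine Post.bind (unionNSP_spec (P := P) h₁.good hc₁ (hl₁.lt f (by simp))) ?_
    rintro _ s₂ ⟨h₂, hm₂⟩
    obtain ⟨hl₂, hc₂⟩ := (hl₁.perm (B := f :: j :: t :: A) (by grind)).merge hf hm₂ h₂.le_size
    refine rest s₂ (h₁.toStep.trans h₂) hl₂ fun z hz => ?_
    rw [hc₂ z hz, h₁.attached_eq z (hl.lt z (by grind))]
  · exact rest s₁ (h₁.toStep.weaken (by omega) le_rfl le_rfl)
      (hl₁.perm (B := f :: j :: t :: A) (by grind)).tail
      fun z hz => h₁.attached_eq z (hl.lt z (by grind))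

theorem join_attached_spec (hs : s.Good) (hl : Live s (j :: f :: A)) (a₁ a₂ : ℕ) :
    Post (do
      let c₁ ← attachedSet t
      let c₂ ← attachedSet o
      let _ ← attachify f (c₁.toList ++ c₂.toList)
      attachNew j [a₁, a₂]
      return j) s fun j' s' =>
      Step P s s' 25 0 2 ∧ Live s' (j' :: A) ∧ s'.count (j' :: A) = s.count A + 1 := by
  refine Post.bind (attachedSet_spec (P := P) hs t) ?_
  rintro c₁ s₁ ⟨h₁, -⟩
  refine Post.bind (attachedSet_spec (P := P) h₁.good o) ?_
  rintro c₂ s₂ ⟨h₂, -⟩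
  have h₀₂ := h₁.trans h₂
  have hl₂ := (h₀₂.live hl).perm (.swap f j A)
  refine Post.bind (attachify_spec (P := P) h₂.good (hl₂.lt f (by simp))
    (by cases c₁ <;> cases c₂ <;> simp)) ?_
  rintro _ s₃ ⟨h₃, ha₃⟩
  obtain ⟨hl₃, -, hc₃⟩ := hl₂.attach ha₃ h₃.le_size
  refine Post.bind (attachNew_spec (P := P) h₃.good (hl₃.lt j (by simp)) (by simp)) ?_
  rintro _ s₄ ⟨h₄, ha₄⟩
  obtain ⟨hl₄, hj₄, hc₄⟩ := hl₃.tail.attach ha₄ h₄.le_size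
  refine Post.pure ⟨(h₀₂.toStep.trans h₃).trans h₄, hl₄, ?_⟩
  rw [count_cons, hj₄, if_pos rfl]
  congr 1
  refine count_congr fun z hz => ?_
  rw [hc₄ z hz, hc₃ z (by simp [hz]), h₀₂.attached_eq z (hl.lt z (by simp [hz]))]

end Join

/-- The weight 2 is dictated by the case of two attached ends: at most two insertions, while `t` and
`J.childEnd` give way to the single attached `j`. In the other cases nothing is inserted and the
count does not rise. -/
theorem joinOne_spec {P : Params} {s : Detector} {A : List ℕ} {first t : ℕ} {J : Pending}
    (hs : s.Good) (hf : first < s.nsp.size) (hchild : J.child < s.nsp.size)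
    (hcont : J.cont < s.nsp.size) (hl : Live s (t :: J.fork :: J.childEnd :: A)) :
    Post (joinOne first t J) s fun j s' => Step P s s' 120 1 2 ∧ Live s' (j :: A) ∧
      s'.insertLog.length + 2 * s'.count (j :: A) ≤
        s.insertLog.length + 2 * s.count (t :: J.fork :: J.childEnd :: A) := by
  refine Post.bind (tick_spec (P := P) hs 1) fun _ s₁ h₁ => ?_
  refine Post.bind (newStrand_live (P := P) h₁.good (h₁.live hl)) ?_
  rintro j s₂ ⟨h₂, hl₂, hj₂⟩
  have h₀₂ := h₁.trans h₂
  refine Post.bind (unionSP_spec (P := P) h₂.good (hf.trans_le h₀₂.le_size)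
    (hchild.trans_le h₀₂.le_size)) fun _ s₃ h₃ => ?_
  refine Post.bind (unionSP_spec (P := P) h₃.good (hf.trans_le (h₀₂.trans h₃).le_size)
    ((h₃.live hl₂).lt j (by simp))) fun _ s₄ h₄ => ?_
  refine Post.bind (attachedSet_spec (P := P) h₄.good J.childEnd) ?_
  rintro a₁ s₅ ⟨h₅, ha₁⟩
  refine Post.bind (attachedSet_spec (P := P) h₅.good t) ?_
  rintro a₂ s₆ ⟨h₆, ha₂⟩
  have h₂₆ := ((h₃.trans h₄).trans h₅).trans h₆
  have h₀₆ := h₀₂.trans h₂₆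
  have hl₆ := h₂₆.live hl₂
  have hj₆ : s₆.attached j = false := by rw [h₂₆.attached_eq j (hl₂.lt j (by simp)), hj₂]
  have hcount := h₀₆.count hl
  have hlog := h₀₆.log_le
  have h₀₄ := (h₀₂.trans h₃).trans h₄
  have h₅₆ := h₅.trans h₆
  replace ha₁ : a₁.isSome = s₆.attached J.childEnd := by
    have := (h₀₄.live hl).lt J.childEnd (by simp)
    rw [ha₁ this, h₅₆.attached_eq _ this]
  replace ha₂ : a₂.isSome = s₆.attached t := by
    have := ((h₀₄.trans h₅).live hl).lt t (by simp)
    rw [ha₂ this, h₆.attached_eq _ this]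
  simp only [count_cons] at hcount
  have hs₆ := h₆.good
  rcases a₁ with _ | a₁ <;> rcases a₂ with _ | a₂ <;>
    simp only [Option.isSome_none, Option.isSome_some] at ha₁ ha₂ <;>
    simp only [count_cons s, ← hcount, ← ha₁, ← ha₂, Bool.false_eq_true, if_false, if_true]
  · refine (join_unattached_spec (P := P) hs₆ hl₆ hj₆ ha₂.symm ha₁.symm).mono ?_
    rintro j' s' ⟨h, hl', hc⟩
    refine ⟨(h₀₆.toStep.trans h).weaken (by omega) le_rfl (by omega), hl', ?_⟩
    have := h.log_le
    rw [hc, count_cons]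
    omega
  · refine (join_mixed_spec (P := P) hs₆ (A := A) ?_ (hcont.trans_le h₀₆.le_size) hj₆ ha₂.symm _).mono ?_
    · exact (hl₆.perm (B := J.childEnd :: j :: t :: J.fork :: A) (by grind)).tail
    rintro j' s' ⟨h, hl', hc⟩
    refine ⟨(h₀₆.toStep.trans h).weaken (by omega) le_rfl (by omega), hl', ?_⟩
    have := h.log_le
    rw [hc]
    omega
  · refine (join_mixed_spec (P := P) hs₆ (A := A) ?_ (hchild.trans_le h₀₆.le_size) hj₆ ha₁.symm _).mono ?_
    · exact (hl₆.perm (B := t :: j :: J.childEnd :: J.fork :: A) (by grind)).tail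
    rintro j' s' ⟨h, hl', hc⟩
    refine ⟨(h₀₆.toStep.trans h).weaken (by omega) le_rfl (by omega), hl', ?_⟩
    have := h.log_le
    rw [hc]
    omega
  · refine (join_attached_spec (P := P) hs₆ (A := A) ?_ _ _).mono ?_
    · exact (hl₆.perm (B := J.childEnd :: t :: j :: J.fork :: A) (by grind)).tail.tail
    rintro j' s' ⟨h, hl', hc⟩
    refine ⟨(h₀₆.toStep.trans h).weaken (by omega) le_rfl (by omega), hl', ?_⟩
    have := h.log_le
    rw [hc]
    omega

/-! ### Memory accesses -/

section Memory
variable {P : Params} {s : Detector} {A : List ℕ}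

theorem query_spec (hs : s.Good) (u v : ℕ) :
    Post (query u v) s fun _ s' => Quiet P s s' 15 0 0 := by
  refine Post.bind (tick_spec (P := P) hs 1) fun _ s₁ h₁ => ?_
  refine Post.bind (findSP_spec (P := P) h₁.good u) fun r s₂ h₂ => ?_
  refine Post.bind (P := fun t s' => s' = s₂ ∧ t = s₂) ⟨rfl, rfl⟩ ?_
  rintro _ _ ⟨rfl, rfl⟩
  have h₀₂ := h₁.trans h₂
  split_ifs
  · exact Post.pure (h₀₂.weaken (by omega) le_rfl le_rfl)
  · refine Post.bind (succProxy_spec (P := P) h₂.good u) ?_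
    rintro (_ | a) s₃ h₃
    · exact Post.pure ((h₀₂.trans h₃).weaken (by omega) le_rfl le_rfl)
    · refine Post.bind (predProxy_spec (P := P) h₃.good v) fun b s₄ h₄ => ?_
      exact (readR_spec (P := P) h₄.good a b).mono fun _ _ h₅ => ((h₀₂.trans h₃).trans h₄).trans h₅

theorem checkRace_spec (hs : s.Good) (l u v : ℕ) :
    Post (checkRace l u v) s fun _ s' => Quiet P s s' 16 0 0 := by
  refine Post.bind (query_spec (P := P) hs u v) fun b s₁ h₁ => ?_
  split_ifs
  · refine Post.bind (tick_spec (P := P) h₁.good 1) fun _ s₂ h₂ => ?_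
    exact Post.modify ((h₁.trans h₂).tail (Quiet.of_eq h₂.good rfl rfl rfl rfl rfl rfl rfl))
  · exact Post.pure (h₁.weaken (by omega) le_rfl le_rfl)

theorem checkAll_spec (hs : s.Good) (l v : ℕ) (us : List ℕ) :
    Post (checkAll l v us) s fun _ s' => Quiet P s s' (17 * us.length) 0 0 := by
  induction us generalizing s with
  | nil => exact Quiet.refl hs
  | cons u us ih =>
    refine Post.bind (tick_spec (P := P) hs 1) fun _ s₁ h₁ => ?_
    refine Post.bind (checkRace_spec (P := P) h₁.good l u v) fun _ s₂ h₂ => ?_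
    refine (ih h₂.good).mono fun _ s₃ h₃ => ?_
    exact ((h₁.trans h₂).trans h₃).weaken (by rw [List.length_cons]; omega) le_rfl le_rfl

theorem sum_length_update {L l : ℕ} (hl : l < L) (f : ℕ → List ℕ) (r : List ℕ) :
    ∑ x ∈ Finset.range L, (Function.update f l r x).length + (f l).length =
      ∑ x ∈ Finset.range L, (f x).length + r.length := by
  have hmem : l ∈ Finset.range L := Finset.mem_range.2 hl
  rw [← Finset.add_sum_erase _ _ hmem, ← Finset.add_sum_erase _ (fun x => (f x).length) hmem]
  have : ∀ x ∈ (Finset.range L).erase l, (Function.update f l r x).length = (f x).length := by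
    intro x hx
    rw [Function.update_of_ne (Finset.ne_of_mem_erase hx)]
  rw [Finset.sum_congr rfl this, Function.update_self]
  omega

/-- Of the 36 units, 2 are table steps, 17 check the last writer, and 17 prepay the check of the
recorded reader by a later write. -/
theorem onRead_spec (hs : s.Good) (hl : Live s A) {l : ℕ} (hL : l < P.locs) (v : ℕ) :
    Post (onRead l v) s fun _ s' => Step P s s' 36 0 0 ∧ Live s' A ∧ s'.count A = s.count A := by
  refine Post.bind (tick_spec (P := P) hs 2) fun _ s₁ h₁ => ?_
  refine Post.bind (P := fun t s' => s' = s₁ ∧ t = s₁) ⟨rfl, rfl⟩ ?_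
  rintro _ _ ⟨rfl, rfl⟩
  rename_i s₁
  refine Post.bind (checkAll_spec (P := P) h₁.good l v _) fun _ s₂ h₂ => ?_
  have hlen : (s₁.lastWriter l).toList.length ≤ 1 := by cases s₁.lastWriter l <;> simp
  have h₀₂ := (h₁.trans h₂).weaken (c' := 19) (e' := 0) (g' := 0) (by omega) le_rfl le_rfl
  have hs₂ := h₂.good
  have hl₂ := h₀₂.live hl
  refine Post.modify ⟨h₀₂.toStep.trans (c' := 17) (e' := 0) (g' := 0)
    ⟨⟨hs₂.1, hs₂.2, hs₂.3, hs₂.4, hs₂.5⟩, le_rfl, le_rfl, le_rfl, fun _ => ?_⟩,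
    ⟨hl₂.lt, hl₂.distinct⟩, h₀₂.count hl⟩
  have := sum_length_update hL s₂.readers (v :: s₂.readers l)
  rw [List.length_cons] at this
  have hsum : ∑ x ∈ Finset.range P.locs,
      (Function.update s₂.readers l (v :: s₂.readers l) x).length = s₂.pendingReads P + 1 := by
    unfold Detector.pendingReads
    omega
  change s₂.steps + 2 * (s₂.sp.pot P.level P.base + s₂.nsp.pot P.level P.base) +
    17 * (P.level + 1) * ∑ x ∈ Finset.range P.locs,
      (Function.update s₂.readers l (v :: s₂.readers l) x).length + s₂.credit P ≤
    s₂.debit P + s₂.credit P + 17 * (P.level + 1)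
  rw [hsum, Nat.mul_succ]
  unfold Detector.debit
  omega

/-- Checking the readers is free: clearing the list releases exactly the 17 units prepaid for each
of them. -/
theorem onWrite_spec (hs : s.Good) (hl : Live s A) {l : ℕ} (hL : l < P.locs) (v : ℕ) :
    Post (onWrite l v) s fun _ s' => Step P s s' 21 0 0 ∧ Live s' A ∧ s'.count A = s.count A := by
  refine Post.bind (tick_spec (P := P) hs 4) fun _ s₁ h₁ => ?_
  refine Post.bind (P := fun t s' => s' = s₁ ∧ t = s₁) ⟨rfl, rfl⟩ ?_
  rintro _ _ ⟨rfl, rfl⟩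
  rename_i s₁
  refine Post.bind (checkAll_spec (P := P) h₁.good l v _) fun _ s₂ h₂ => ?_
  have hlen : (s₁.lastWriter l).toList.length ≤ 1 := by cases s₁.lastWriter l <;> simp
  have h₀₂ := (h₁.trans h₂).weaken (c' := 21) (e' := 0) (g' := 0) (by omega) le_rfl le_rfl
  refine Post.bind (P := fun t s' => s' = s₂ ∧ t = s₂) ⟨rfl, rfl⟩ ?_
  rintro _ _ ⟨rfl, rfl⟩
  rename_i s₂
  refine Post.bind (checkAll_spec (P := P) h₂.good l v _) fun _ s₃ h₃ => ?_
  have h₀₃ := h₀₂.trans h₃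
  have hs₃ := h₃.good
  have hl₃ := h₀₃.live hl
  -- The checks of the readers and the clearing of the list form a single step of cost 0; either one
  -- alone would not balance.
  refine Post.modify ⟨h₀₂.toStep.trans (c' := 0) (e' := 0) (g' := 0)
    ⟨⟨hs₃.1, hs₃.2, hs₃.3, hs₃.4, hs₃.5⟩, h₃.le_size, h₃.size_le, h₃.log_le, fun hN => ?_⟩,
    ⟨hl₃.lt, hl₃.distinct⟩, h₀₃.count hl⟩
  have h := h₃.debit_le hN
  have hr := h₃.readers_eq
  have := sum_length_update hL s₃.readers []
  rw [List.length_nil, add_zero, hr] at this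
  have hsum : s₃.pendingReads P = ∑ x ∈ Finset.range P.locs,
      (Function.update s₃.readers l [] x).length + (s₂.readers l).length := by
    unfold Detector.pendingReads
    rw [hr]
    omega
  change s₃.steps + 2 * (s₃.sp.pot P.level P.base + s₃.nsp.pot P.level P.base) +
    17 * (P.level + 1) * ∑ x ∈ Finset.range P.locs,
      (Function.update s₃.readers l [] x).length + s₂.credit P ≤
    s₂.debit P + s₃.credit P + 0 * (P.level + 1)
  rw [Detector.debit, hsum] at h
  have e : 17 * (s₂.readers l).length * (P.level + 1) =
    17 * (P.level + 1) * (s₂.readers l).length := by ring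
  rw [e, Nat.mul_add (17 * (P.level + 1)) _ (s₂.readers l).length] at h
  omega

end Memory

/-! ### Parallel control -/

/-- The live strands of the outstanding children: forks and last strands. -/
def liveOf : List Pending → List ℕ
  | [] => []
  | J :: js => J.fork :: J.childEnd :: liveOf js

section Control
variable {P : Params} {s : Detector} {A : List ℕ} {first u : ℕ}

theorem onSync_spec (hs : s.Good) (hf : first < s.nsp.size) (pend : List Pending)
    (hp : ∀ J ∈ pend, J.child < s.nsp.size ∧ J.cont < s.nsp.size)
    (hl : Live s (u :: (liveOf pend ++ A))) :
    Post (onSync first u pend) s fun j s' =>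
      Step P s s' (120 * pend.length) pend.length (2 * pend.length) ∧ Live s' (j :: A) ∧
      s'.insertLog.length + 2 * s'.count (j :: A) ≤
        s.insertLog.length + 2 * s.count (u :: (liveOf pend ++ A)) := by
  induction pend generalizing s u with
  | nil => exact ⟨Step.refl hs, hl, le_rfl⟩
  | cons J js ih =>
    obtain ⟨h1, h2⟩ := hp J List.mem_cons_self
    refine Post.bind (joinOne_spec (P := P) hs hf h1 h2 hl) ?_
    rintro j s₁ ⟨h₁, hl₁, hc₁⟩
    refine (ih h₁.good (hf.trans_le h₁.le_size) (fun J' hJ' => ?_) hl₁).mono ?_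
    · have := hp J' (List.mem_cons_of_mem _ hJ')
      exact ⟨this.1.trans_le h₁.le_size, this.2.trans_le h₁.le_size⟩
    rintro j' s₂ ⟨h₂, hl₂, hc₂⟩
    refine ⟨(h₁.trans h₂).weaken ?_ ?_ ?_, hl₂, hc₂.trans hc₁⟩ <;> rw [List.length_cons] <;> omega

theorem onSpawn_spec (hs : s.Good) (hf : first < s.nsp.size) (hl : Live s (u :: A)) :
    Post (onSpawn first u) s fun vw s' => Quiet P s s' 62 2 0 ∧
      Live s' (vw.1 :: vw.2 :: u :: A) ∧ s'.count (vw.1 :: vw.2 :: u :: A) = s.count (u :: A) := by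
  refine Post.bind (newStrand_live (P := P) hs hl) ?_
  rintro v s₁ ⟨h₁, hl₁, hv₁⟩
  refine Post.bind (newStrand_live (P := P) h₁.good hl₁) ?_
  rintro w s₂ ⟨h₂, hl₂, hw₂⟩
  refine Post.bind (unionSP_spec (P := P) h₂.good (hf.trans_le (h₁.trans h₂).le_size)
    (hl₂.lt w (by simp))) fun _ s₃ h₃ => ?_
  refine Post.bind (predProxy_spec (P := P) h₃.good u) fun a s₄ h₄ => ?_
  refine Post.bind (setAttPred_spec (P := P) h₄.good v a) fun _ s₅ h₅ => ?_
  refine Post.bind (setAttPred_spec (P := P) h₅.good w a) fun _ s₆ h₆ => ?_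
  have h₂₆ := ((h₃.trans h₄).trans h₅).trans h₆
  have hl₂' := hl₂.perm (.swap v w _)
  refine Post.pure ⟨(h₁.trans h₂).trans h₂₆, h₂₆.live hl₂', ?_⟩
  rw [h₂₆.count hl₂', count_cons, count_cons s₂ w, (h₁.trans h₂).count hl,
    h₂.attached_eq v (hl₁.lt v (by simp)), hv₁, hw₂]
  simp

/-- At most three insertions and two new attached live strands: the weighted quantity rises by at
most `3 + 2 * 2 = 7`. The strand `u` ceases to be live. -/
theorem onCreate_spec (hs : s.Good) (hf : first < s.nsp.size) (hl : Live s (u :: A)) :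
    Post (onCreate first u) s fun vw s' => Step P s s' 70 2 3 ∧
      Live s' (vw.1 :: vw.2 :: A) ∧ s'.count (vw.1 :: vw.2 :: A) = s.count A + 2 := by
  refine Post.bind (newStrand_live (P := P) hs hl) ?_
  rintro v s₁ ⟨h₁, hl₁, -⟩
  refine Post.bind (newStrand_live (P := P) h₁.good hl₁) ?_
  rintro w s₂ ⟨h₂, hl₂, -⟩
  refine Post.bind (unionSP_spec (P := P) h₂.good (hf.trans_le (h₁.trans h₂).le_size)
    (hl₂.lt w (by simp))) fun _ s₃ h₃ => ?_
  have h₀₃ := (h₁.trans h₂).trans h₃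
  have hl₃ := (h₃.live hl₂).perm (B := u :: v :: w :: A) (by grind)
  refine Post.bind (attachify_spec (P := P) h₃.good (hl₃.lt u (by simp)) (by simp)) ?_
  rintro a s₄ ⟨h₄, ha₄⟩
  obtain ⟨hl₄, -, hc₄⟩ := hl₃.attach ha₄ h₄.le_size
  replace hl₄ := hl₄.tail
  refine Post.bind (attachNew_spec (P := P) h₄.good (hl₄.lt v (by simp)) (by simp)) ?_
  rintro _ s₅ ⟨h₅, ha₅⟩
  obtain ⟨hl₅, hv₅, hc₅⟩ := hl₄.attach ha₅ h₅.le_size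
  replace hl₅ := hl₅.perm (.swap w v _)
  refine Post.bind (attachNew_spec (P := P) h₅.good (hl₅.lt w (by simp)) (by simp)) ?_
  rintro _ s₆ ⟨h₆, ha₆⟩
  obtain ⟨hl₆, hw₆, hc₆⟩ := hl₅.attach ha₆ h₆.le_size
  refine Post.pure ⟨((h₀₃.toStep.trans h₄).trans h₅).trans h₆, hl₆.perm (.swap v w _), ?_⟩
  rw [count_cons, count_cons, hw₆, hc₆ v (by simp), hv₅, if_pos rfl]
  refine congrArg (· + 2) (?_ : s₆.count A = s.count A)
  refine count_congr fun z hz => ?_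
  rw [hc₆ z (by simp [hz]), hc₅ z (by simp [hz]), hc₄ z (by simp [hz]),
    h₀₃.attached_eq z (hl.lt z (by simp [hz]))]

/-- At most two insertions and one new attached live strand: a rise by at most 4. -/
theorem onGet_spec (hs : s.Good) (hf : first < s.nsp.size) (hl : Live s (u :: A)) (i : ℕ) :
    Post (onGet first u i) s fun w s' => Step P s s' 53 1 2 ∧
      Live s' (w :: A) ∧ s'.count (w :: A) = s.count A + 1 := by
  refine Post.bind (newStrand_live (P := P) hs hl) ?_
  rintro w s₁ ⟨h₁, hl₁, -⟩
  refine Post.bind (unionSP_spec (P := P) h₁.good (hf.trans_le h₁.le_size)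
    (hl₁.lt w (by simp))) fun _ s₂ h₂ => ?_
  have h₀₂ := h₁.trans h₂
  have hl₂ := (h₂.live hl₁).perm (.swap u w _)
  refine Post.bind (attachify_spec (P := P) h₂.good (hl₂.lt u (by simp)) (by simp)) ?_
  rintro a s₃ ⟨h₃, ha₃⟩
  obtain ⟨hl₃, -, hc₃⟩ := hl₂.attach ha₃ h₃.le_size
  replace hl₃ := hl₃.tail
  refine Post.bind (tick_spec (P := P) h₃.good 1) fun _ s₄ h₄ => ?_
  refine Post.bind (P := fun _ s' => s' = s₄) rfl ?_
  rintro t _ rfl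
  rename_i s₄
  refine Post.bind (attachedSet_spec (P := P) h₄.good _) ?_
  rintro b s₅ ⟨h₅, -⟩
  have h₃₅ := h₄.trans h₅
  have hl₅ := h₃₅.live hl₃
  refine Post.bind (attachNew_spec (P := P) h₅.good (hl₅.lt w (by simp))
    (by cases b <;> simp)) ?_
  rintro _ s₆ ⟨h₆, ha₆⟩
  obtain ⟨hl₆, hw₆, hc₆⟩ := hl₅.attach ha₆ h₆.le_size
  refine Post.pure ⟨((h₀₂.toStep.trans h₃).trans h₃₅.toStep).trans h₆, hl₆, ?_⟩
  rw [count_cons, hw₆, if_pos rfl]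
  congr 1
  refine count_congr fun z hz => ?_
  rw [hc₆ z hz, h₃₅.attached_eq z (hl₃.lt z (by simp [hz])), hc₃ z (by simp [hz]),
    h₀₂.attached_eq z (hl.lt z (by simp [hz]))]

theorem newFuture_spec (hs : s.Good) : Post newFuture s fun _ s' => Quiet P s s' 1 0 0 := by
  refine Post.bind (tick_spec (P := P) hs 1) fun _ s₁ h₁ => ?_
  exact h₁.tail (Quiet.of_eq (s' := { s₁ with futCount := s₁.futCount + 1 }) h₁.good
    rfl rfl rfl rfl rfl rfl rfl)

theorem finishFuture_spec (hs : s.Good) (i t : ℕ) :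
    Post (finishFuture i t) s fun _ s' => Quiet P s s' 1 0 0 := by
  refine Post.bind (tick_spec (P := P) hs 1) fun _ s₁ h₁ => ?_
  exact Post.modify (h₁.tail (Quiet.of_eq h₁.good rfl rfl rfl rfl rfl rfl rfl))

end Control

/-! ### The run -/

/-- A bound for the memory locations that a program accesses. -/
def Code.locBound : Code → ℕ
  | ret => 0
  | compute r => r.locBound
  | read l r => max (l + 1) r.locBound
  | write l r => max (l + 1) r.locBound
  | call b r => max b.locBound r.locBound
  | spawn b r => max b.locBound r.locBound
  | create b r => max b.locBound r.locBound
  | get _ r => r.locBound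
  | sync r => r.locBound

/-- `A` holds the live strands of the suspended instances. Each outstanding child in `pend` stands
for a join still to come, of 120 units and one strand. A `spawn` is the most expensive instruction:
67 units of its own and 120 for its join, within 190. It accounts for three strands, two at the fork
and one at the join. -/
theorem exec_spec {P : Params} (p : Code) (hP : p.locBound ≤ P.locs) {s : Detector} {A : List ℕ}
    {first cur : ℕ} (pend : List Pending) (hs : s.Good) (hf : first < s.nsp.size)
    (hp : ∀ J ∈ pend, J.child < s.nsp.size ∧ J.cont < s.nsp.size)
    (hl : Live s (cur :: (liveOf pend ++ A))) :
    Post (exec p first cur pend) s fun t s' =>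
      Step P s s' (190 * p.work + 120 * pend.length) (3 * p.forks + p.futureOps + pend.length)
        (3 * p.work + 2 * pend.length) ∧
      Live s' (t :: A) ∧
      s'.insertLog.length + 2 * s'.count (t :: A) ≤
        s.insertLog.length + 2 * s.count (cur :: (liveOf pend ++ A)) + 7 * p.futureOps := by
  induction p generalizing s A first cur pend with
  | ret =>
    refine Post.bind (tick_spec (P := P) hs 1) fun _ s₁ h₁ => ?_
    refine (onSync_spec (P := P) h₁.good (hf.trans_le h₁.le_size) pend
      (fun J hJ => ⟨(hp J hJ).1.trans_le h₁.le_size, (hp J hJ).2.trans_le h₁.le_size⟩)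
      (h₁.live hl)).mono ?_
    rintro t s₂ ⟨h₂, hl₂, hc₂⟩
    refine ⟨(h₁.toStep.trans h₂).weaken ?_ ?_ ?_, hl₂, ?_⟩
    · simp only [Code.work]; omega
    · omega
    · omega
    · rw [h₁.count hl] at hc₂
      have := h₁.log_le
      omega
  | compute r ih =>
    refine Post.bind (tick_spec (P := P) hs 1) fun _ s₁ h₁ => ?_
    refine (ih hP pend h₁.good (hf.trans_le h₁.le_size)
      (fun J hJ => ⟨(hp J hJ).1.trans_le h₁.le_size, (hp J hJ).2.trans_le h₁.le_size⟩)
      (h₁.live hl)).mono ?_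
    rintro t s₂ ⟨h₂, hl₂, hc₂⟩
    rw [h₁.count hl] at hc₂
    have := h₁.log_le
    refine ⟨(h₁.toStep.trans h₂).weaken ?_ ?_ ?_, hl₂, ?_⟩ <;>
      simp only [Code.work, Code.forks, Code.futureOps] <;> omega
  | read l r ih =>
    simp only [Code.locBound] at hP
    refine Post.bind (tick_spec (P := P) hs 1) fun _ s₁ h₁ => ?_
    refine Post.bind (onRead_spec (P := P) h₁.good (h₁.live hl) (by omega) cur) ?_
    rintro _ s₂ ⟨h₂, hl₂, hc₂⟩
    have h₀₂ := h₁.toStep.trans h₂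
    refine (ih (by omega) pend h₂.good (hf.trans_le h₀₂.le_size)
      (fun J hJ => ⟨(hp J hJ).1.trans_le h₀₂.le_size, (hp J hJ).2.trans_le h₀₂.le_size⟩) hl₂).mono ?_
    rintro t s₃ ⟨h₃, hl₃, hc₃⟩
    rw [hc₂, h₁.count hl] at hc₃
    have := h₀₂.log_le
    refine ⟨(h₀₂.trans h₃).weaken ?_ ?_ ?_, hl₃, ?_⟩ <;>
      simp only [Code.work, Code.forks, Code.futureOps] <;> omega
  | write l r ih =>
    simp only [Code.locBound] at hP
    refine Post.bind (tick_spec (P := P) hs 1) fun _ s₁ h₁ => ?_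
    refine Post.bind (onWrite_spec (P := P) h₁.good (h₁.live hl) (by omega) cur) ?_
    rintro _ s₂ ⟨h₂, hl₂, hc₂⟩
    have h₀₂ := h₁.toStep.trans h₂
    refine (ih (by omega) pend h₂.good (hf.trans_le h₀₂.le_size)
      (fun J hJ => ⟨(hp J hJ).1.trans_le h₀₂.le_size, (hp J hJ).2.trans_le h₀₂.le_size⟩) hl₂).mono ?_
    rintro t s₃ ⟨h₃, hl₃, hc₃⟩
    rw [hc₂, h₁.count hl] at hc₃
    have := h₀₂.log_le
    refine ⟨(h₀₂.trans h₃).weaken ?_ ?_ ?_, hl₃, ?_⟩ <;>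
      simp only [Code.work, Code.forks, Code.futureOps] <;> omega
  | call b r ihb ihr =>
    simp only [Code.locBound] at hP
    refine Post.bind (tick_spec (P := P) hs 1) fun _ s₁ h₁ => ?_
    -- The callee joins none of the caller's children, so these move to the frame for the duration
    -- of the call.
    refine Post.bind (ihb (by omega) [] (A := liveOf pend ++ A) h₁.good (hf.trans_le h₁.le_size)
      (by simp) (h₁.live hl)) ?_
    rintro t s₂ ⟨h₂, hl₂, hc₂⟩
    have h₀₂ := h₁.toStep.trans h₂
    refine (ihr (by omega) pend h₂.good (hf.trans_le h₀₂.le_size)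
      (fun J hJ => ⟨(hp J hJ).1.trans_le h₀₂.le_size, (hp J hJ).2.trans_le h₀₂.le_size⟩) hl₂).mono ?_
    rintro t s₃ ⟨h₃, hl₃, hc₃⟩
    change _ ≤ _ + 2 * s₁.count (cur :: (liveOf pend ++ A)) + _ at hc₂
    rw [h₁.count hl] at hc₂
    have := h₁.log_le
    refine ⟨(h₀₂.trans h₃).weaken ?_ ?_ ?_, hl₃, ?_⟩ <;>
      simp only [Code.work, Code.forks, Code.futureOps, List.length_nil] <;> omega
  | spawn b r ihb ihr =>
    simp only [Code.locBound] at hP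
    refine Post.bind (tick_spec (P := P) hs 1) fun _ s₁ h₁ => ?_
    refine Post.bind (onSpawn_spec (P := P) h₁.good (hf.trans_le h₁.le_size) (h₁.live hl)) ?_
    rintro ⟨v, w⟩ s₂ ⟨h₂, hl₂, hc₂⟩
    have h₀₂ := h₁.trans h₂
    have hv := hl₂.lt v (by simp)
    have hw := hl₂.lt w (by simp)
    refine Post.bind (ihb (by omega) [] (A := w :: cur :: (liveOf pend ++ A)) h₂.good hv
      (by simp) hl₂) ?_
    rintro t s₃ ⟨h₃, hl₃, hc₃⟩
    refine Post.bind (toP_spec (P := P) h₃.good v) fun _ s₄ h₄ => ?_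
    have h₂₄ := h₃.trans h₄.toStep
    have h₀₄ := h₀₂.toStep.trans h₂₄
    have hperm : (t :: w :: cur :: (liveOf pend ++ A)).Perm
        (w :: (liveOf (⟨cur, v, w, t⟩ :: pend) ++ A)) := by
      simp only [liveOf, List.cons_append]
      exact ((List.Perm.swap w t _).trans (.cons _ (.swap cur t _)))
    have hl₄ := (h₄.live hl₃).perm hperm
    refine (ihr (by omega) (⟨cur, v, w, t⟩ :: pend) h₄.good (hf.trans_le h₀₄.le_size)
      (fun J hJ => ?_) hl₄).mono ?_
    · rcases List.mem_cons.1 hJ with rfl | hJ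
      · exact ⟨hv.trans_le h₂₄.le_size, hw.trans_le h₂₄.le_size⟩
      · exact ⟨(hp J hJ).1.trans_le h₀₄.le_size, (hp J hJ).2.trans_le h₀₄.le_size⟩
    rintro t' s₅ ⟨h₅, hl₅, hc₅⟩
    change _ ≤ _ + 2 * s₂.count (v :: w :: cur :: (liveOf pend ++ A)) + _ at hc₃
    have hcp : s₄.count (w :: (liveOf (⟨cur, v, w, t⟩ :: pend) ++ A)) =
        s₃.count (t :: w :: cur :: (liveOf pend ++ A)) := by
      rw [← h₄.count hl₃]
      exact (hperm.countP_eq _).symm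
    rw [hc₂, h₁.count hl] at hc₃
    rw [hcp] at hc₅
    have := h₀₂.log_le
    have := h₄.log_le
    refine ⟨(h₀₄.trans h₅).weaken ?_ ?_ ?_, hl₅, ?_⟩ <;>
      simp only [Code.work, Code.forks, Code.futureOps, List.length_nil, List.length_cons] <;> omega
  | create b r ihb ihr =>
    simp only [Code.locBound] at hP
    refine Post.bind (tick_spec (P := P) hs 1) fun _ s₁ h₁ => ?_
    refine Post.bind (onCreate_spec (P := P) h₁.good (hf.trans_le h₁.le_size) (h₁.live hl)) ?_
    rintro ⟨v, w⟩ s₂ ⟨h₂, hl₂, hc₂⟩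
    have h₀₂ := h₁.toStep.trans h₂
    refine Post.bind (newFuture_spec (P := P) h₂.good) fun i s₃ h₃ => ?_
    have hl₃ := h₃.live hl₂
    refine Post.bind (ihb (by omega) [] (A := w :: (liveOf pend ++ A)) h₃.good
      (hl₃.lt v (by simp)) (by simp) hl₃) ?_
    rintro t s₄ ⟨h₄, hl₄, hc₄⟩
    refine Post.bind (toP_spec (P := P) h₄.good v) fun _ s₅ h₅ => ?_
    refine Post.bind (finishFuture_spec (P := P) h₅.good i t) fun _ s₆ h₆ => ?_
    have h₄₆ := h₅.trans h₆
    have h₀₆ := ((h₀₂.trans h₃.toStep).trans h₄).trans h₄₆.toStep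
    refine (ihr (by omega) pend h₆.good (hf.trans_le h₀₆.le_size)
      (fun J hJ => ⟨(hp J hJ).1.trans_le h₀₆.le_size, (hp J hJ).2.trans_le h₀₆.le_size⟩)
      (h₄₆.live hl₄.tail)).mono ?_
    rintro t' s₇ ⟨h₇, hl₇, hc₇⟩
    change _ ≤ _ + 2 * s₃.count (v :: w :: (liveOf pend ++ A)) + _ at hc₄
    rw [h₃.count hl₂, hc₂, h₁.count hl.tail] at hc₄
    rw [h₄₆.count hl₄.tail] at hc₇
    rw [count_cons s₄ t] at hc₄
    rw [count_cons s cur]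
    have := h₀₂.log_le
    have := h₃.log_le
    have := h₄₆.log_le
    refine ⟨(h₀₆.trans h₇).weaken ?_ ?_ ?_, hl₇, ?_⟩ <;>
      simp only [Code.work, Code.forks, Code.futureOps, List.length_nil] <;> omega
  | get i r ih =>
    refine Post.bind (tick_spec (P := P) hs 1) fun _ s₁ h₁ => ?_
    refine Post.bind (onGet_spec (P := P) h₁.good (hf.trans_le h₁.le_size) (h₁.live hl) i) ?_
    rintro w s₂ ⟨h₂, hl₂, hc₂⟩
    have h₀₂ := h₁.toStep.trans h₂
    refine (ih hP pend h₂.good (hf.trans_le h₀₂.le_size)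
      (fun J hJ => ⟨(hp J hJ).1.trans_le h₀₂.le_size, (hp J hJ).2.trans_le h₀₂.le_size⟩) hl₂).mono ?_
    rintro t s₃ ⟨h₃, hl₃, hc₃⟩
    rw [hc₂, h₁.count hl.tail] at hc₃
    rw [count_cons s cur]
    have := h₀₂.log_le
    refine ⟨(h₀₂.trans h₃).weaken ?_ ?_ ?_, hl₃, ?_⟩ <;>
      simp only [Code.work, Code.forks, Code.futureOps] <;> omega
  | sync r ih =>
    refine Post.bind (tick_spec (P := P) hs 1) fun _ s₁ h₁ => ?_
    refine Post.bind (onSync_spec (P := P) h₁.good (hf.trans_le h₁.le_size) pend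
      (fun J hJ => ⟨(hp J hJ).1.trans_le h₁.le_size, (hp J hJ).2.trans_le h₁.le_size⟩)
      (h₁.live hl)) ?_
    rintro j s₂ ⟨h₂, hl₂, hc₂⟩
    have h₀₂ := h₁.toStep.trans h₂
    refine (ih hP [] (A := A) h₂.good (hf.trans_le h₀₂.le_size) (by simp) hl₂).mono ?_
    rintro t s₃ ⟨h₃, hl₃, hc₃⟩
    change _ ≤ _ + 2 * s₂.count (j :: A) + _ at hc₃
    rw [h₁.count hl] at hc₂
    have := h₁.log_le
    refine ⟨(h₀₂.trans h₃).weaken ?_ ?_ ?_, hl₃, ?_⟩ <;>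
      simp only [Code.work, Code.forks, Code.futureOps, List.length_nil] <;> omega

theorem Detector.init_good : Detector.init.Good :=
  ⟨Forest.empty_wf, Forest.empty_wf, rfl, rfl, by simp [Detector.init]⟩

theorem Detector.init_live : Live Detector.init [] := ⟨by simp, by simp⟩

/-- The run of the detector, from the empty state. -/
theorem multiBagsPlus_spec (P : Params) (p : Code) (hP : p.locBound ≤ P.locs) :
    Step P Detector.init (multiBagsPlus p) (190 * p.work + 26) (3 * p.forks + p.futureOps + 1)
        (3 * p.work + 1) ∧
      (multiBagsPlus p).insertLog.length ≤ 7 * p.futureOps + 3 := by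
  have : Post (do
      let x ← newStrand
      attachNew x []
      let _ ← exec p x x []
      toP x) Detector.init fun _ s' =>
      Step P Detector.init s' (190 * p.work + 26) (3 * p.forks + p.futureOps + 1)
        (3 * p.work + 1) ∧ s'.insertLog.length ≤ 7 * p.futureOps + 3 := by
    refine Post.bind (newStrand_live (P := P) Detector.init_good Detector.init_live) ?_
    rintro x s₁ ⟨h₁, hl₁, -⟩
    refine Post.bind (attachNew_spec (P := P) h₁.good (hl₁.lt x (by simp)) (by simp)) ?_
    rintro _ s₂ ⟨h₂, ha₂⟩
    obtain ⟨hl₂, hx₂, -⟩ := hl₁.attach ha₂ h₂.le_size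
    have hx := hl₂.lt x (by simp)
    refine Post.bind (exec_spec (P := P) p hP [] (A := []) h₂.good hx (by simp) hl₂) ?_
    rintro t s₃ ⟨h₃, -, hc₃⟩
    refine (toP_spec (P := P) h₃.good x).mono fun _ s₄ h₄ => ?_
    have hlog := (h₁.toStep.trans h₂).log_le
    have hlog₄ := h₄.log_le
    change _ ≤ _ + 2 * s₂.count [x] + _ at hc₃
    -- The first strand accounts for the constant 3: one insertion and one attached live strand of
    -- weight 2.
    rw [count_cons s₂, hx₂, if_pos rfl] at hc₃
    change s₂.insertLog.length ≤ 0 + _ at hlog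
    have h0 : s₂.count [] = 0 := rfl
    rw [List.length_nil] at h₃
    refine ⟨(((h₁.toStep.trans h₂).trans h₃).trans h₄.toStep).weaken ?_ ?_ ?_, ?_⟩ <;> omega
  exact this

/-- Level and base stay free, to be balanced against `m`, `n` and `k` afterwards. The initial debit
is 0, and the final debit bounds the number of steps. -/
theorem multiBagsPlus_steps_le (p : Code) {i b : ℕ}
    (h : Nat.log 2 (3 * p.forks + p.futureOps + 1) ≤ fastGrow i (b + 1)) :
    (multiBagsPlus p).steps ≤ (multiBagsPlus p).insertLog.sum +
      4 * b * (3 * p.forks + p.futureOps + 1) + (190 * p.work + 26) * (i + 1) := by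
  -- The number of strands allowed is the bound that the run itself satisfies, so the condition in
  -- `Step.debit_le` is met.
  obtain ⟨hst, -⟩ := multiBagsPlus_spec ⟨i, b, 3 * p.forks + p.futureOps + 1, p.locBound, h⟩ p le_rfl
  have hsize : (multiBagsPlus p).nsp.size ≤ 3 * p.forks + p.futureOps + 1 := by
    have := hst.size_le
    change _ ≤ 0 + _ at this
    omega
  have hd := hst.debit_le hsize
  have hinit : Detector.init.debit
      ⟨i, b, 3 * p.forks + p.futureOps + 1, p.locBound, h⟩ = 0 := by
    simp [Detector.debit, Detector.init, Forest.empty_pot, Detector.pendingReads]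
  rw [hinit] at hd
  have hcr := Nat.mul_le_mul_left (4 * b) hsize
  simp only [Detector.debit, Detector.credit] at hd
  omega

/-! ### The final estimate. -/

theorem Code.accesses_lt (p : Code) : p.accesses < p.work := by
  induction p <;> simp only [Code.accesses, Code.work] <;> omega

theorem Code.forks_lt (p : Code) : p.forks < p.work := by
  induction p <;> simp only [Code.forks, Code.work] <;> omega

/-- The infimum is attained because the set is nonempty: `ack i x > i`. -/
theorem invAck_spec (m n : ℕ) : 1 ≤ invAck m n ∧ Nat.clog 2 n ≤ ack (invAck m n) (m / n) :=
  Nat.sInf_mem (s := {i : ℕ | 1 ≤ i ∧ Nat.clog 2 n ≤ ack i (m / n)})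
    ⟨Nat.clog 2 n + 1, by omega, ((Nat.lt_succ_self _).trans (lt_ack_left _ _)).le⟩

/-- The number of insertions into `R` and the cost of each of them are linear in the number of
future operations. -/
theorem insertLog_bounds (p : Code) :
    (multiBagsPlus p).insertLog.length ≤ 7 * p.futureOps + 3 ∧
      ∀ c ∈ (multiBagsPlus p).insertLog, c ≤ 35 * p.futureOps + 18 := by
  -- Counting insertions does not involve the potential, so trivial parameters do.
  obtain ⟨h1, h2⟩ := multiBagsPlus_spec ⟨0, 0, 0, p.locBound, by simp⟩ p le_rfl
  refine ⟨h2, fun c hc => ?_⟩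
  have := h1.good.insertLog_le c hc
  omega

theorem multiBagsPlus_steps_le_invAck (p : Code) : (multiBagsPlus p).steps ≤
    2000 * (p.work * invAck p.accesses p.forks + p.futureOps ^ 2) := by
  obtain ⟨hlen, hle⟩ := insertLog_bounds p
  have hsum := (List.sum_le_card_nsmul _ _ hle).trans (Nat.mul_le_mul_right _ hlen)
  obtain ⟨hα, hack⟩ := invAck_spec p.accesses p.forks
  have hw := p.accesses_lt
  have hn := p.forks_lt
  have hstep := @multiBagsPlus_steps_le p
  generalize (multiBagsPlus p).steps = S at *
  generalize (multiBagsPlus p).insertLog.sum = I at *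
  clear hle hlen
  generalize invAck p.accesses p.forks = α at *
  generalize p.accesses = m at *
  generalize p.forks = n at *
  generalize p.work = T at *
  generalize p.futureOps = k at *
  have hT : T ≤ T * α := Nat.le_mul_of_pos_right _ hα
  -- All insertions together take at most `(7 * k + 3) * (35 * k + 18)` steps; the constant term is
  -- absorbed by `T ≥ 1`.
  have hI : I ≤ 500 * T + 500 * k ^ 2 := by nlinarith
  rcases le_or_gt k n with hkn | hkn
  -- With `k ≤ n` there are at most `4 * n + 1` strands, so their logarithm exceeds that of `n` by
  -- at most 3. The base `m / n + 3` times the number of strands is `O(m + n + 1)`, hence `O(T)`.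
  · have hlog : Nat.log 2 (3 * n + k + 1) ≤ fastGrow α (m / n + 3 + 1) := by
      refine le_trans ?_ (ack_add_le_fastGrow α (m / n) 4 (by omega))
      have h1 : 3 * n + k + 1 ≤ 2 ^ (Nat.clog 2 n + 3) := by
        have := Nat.le_pow_clog (b := 2) (by norm_num) n
        have := Nat.one_le_two_pow (n := Nat.clog 2 n)
        rw [pow_add]
        omega
      have h2 := Nat.log_mono_right (b := 2) h1
      rw [Nat.log_pow (by norm_num)] at h2
      omega
    have h := hstep hlog
    have hdiv : m / n * n ≤ m := Nat.div_mul_le_self m n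
    have hb : 4 * (m / n + 3) * (3 * n + k + 1) ≤ 20 * m + 80 * n + 16 + 4 * (m / n):= by
      generalize m / n = d at *
      nlinarith
    have hdm : m / n ≤ m := Nat.div_le_self m n
    have hu : (190 * T + 26) * (α + 1) ≤ 432 * (T * α) := by nlinarith
    nlinarith
  -- With `k > n` there are fewer than `4 * k` strands, so a base of `4 * k` makes level 1
  -- sufficient, and base times strands is `O(k ^ 2)`.
  · have hlog : Nat.log 2 (3 * n + k + 1) ≤ fastGrow 1 (4 * k + 1) := by
      refine (Nat.log_le_self _ _).trans (le_trans ?_ (lt_fastGrow _ _).le)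
      omega
    have h := hstep hlog
    nlinarith

end FutureRace

theorem mainTheorem1 :
    ∃ C : ℕ, ∀ p : FutureRace.Code, p.Runs →
      (FutureRace.multiBagsPlus p).steps ≤
          C * (p.work * FutureRace.invAck p.accesses p.forks + p.futureOps ^ 2) ∧
        (FutureRace.multiBagsPlus p).insertLog.length ≤ C * (p.futureOps + 1) ∧
        ∀ c ∈ (FutureRace.multiBagsPlus p).insertLog, c ≤ C * (p.futureOps + 1) := by
  refine ⟨2000, fun p _ => ⟨FutureRace.multiBagsPlus_steps_le_invAck p, ?_⟩⟩
  obtain ⟨hlen, hle⟩ := FutureRace.insertLog_bounds p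
  refine ⟨by omega, fun c hc => ?_⟩
  have := hle c hc
  omega
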